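/- Let $R$ be a (not necessarily commutative) profinite ring with unity, and let $R\text{-}\mathsf{PMod}$ be the category of profinite left $R$-modules and continuous $R$-linear maps. For a profinite space $X$ let $\mathcal{O}(X)$ be the poset of clopen subsets of $X$. A *precosheaf* of profinite $R$-modules is a pair $(\mathsf{M},X)$ of a profinite space $X$ and a functor $\mathsf{M}\colon\mathcal{O}(X)\to R\text{-}\mathsf{PMod}$, with maps $\mathrm{cor}_U^V\colon \mathsf{M}(U)\to\mathsf{M}(V)$ for $U\subseteq V$. A morphism $(\Psi,f)\colon(\mathsf{N},Y)\to(\mathsf{M},X)$ consists of a continuous map $f\colon Y\to X$ and continuous $R$-linear maps $\Psi_{U,V}\colon \mathsf{N}(f^{-1}(U)\cap V)\to\mathsf{M}(U)$, natural in $(U,V)\in\mathcal{O}(X)\times\mathcal{O}(Y)$. A *cosheaf* is a precosheaf such that for every finite (possibly empty) family $U_1,\dots,U_n\in\mathcal{O}(X)$ the sequence $$\bigoplus_{i,j}\mathsf{M}(U_i\cap U_j)\xrightarrow{\;p-q\;}\bigoplus_i\mathsf{M}(U_i)\longrightarrow\mathsf{M}(U_1\cup\dots\cup U_n)\longrightarrow0$$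 is exact, where $p=\sum_{i,j}\mathrm{cor}_{U_i\cap U_j}^{U_i}$ and $q=\sum_{i,j}\mathrm{cor}_{U_i\cap U_j}^{U_j}$. Cosheaves and morphisms of precosheaves between them form the category $R\text{-}\mathsf{CoShf}$. A *`sheaf'* of profinite $R$-modules is a triple $(\mathcal{M},p,X)$ of a continuous surjection $p\colon\mathcal{M}\to X$ of profinite spaces and a profinite $R$-module structure on each fibre $M_x=p^{-1}(x)$ such that scalar multiplication $R\times\mathcal{M}\to\mathcal{M}$ and addition $\mathcal{M}\times_X\mathcal{M}\to\mathcal{M}$ are continuous. A morphism $(\psi,f)\colon(\mathcal{N},q,Y)\to(\mathcal{M},p,X)$ consists of continuous maps $\psi\colon\mathcal{N}\to\mathcal{M}$ and $f\colon Y\to X$ with $p\psi=fq$ such that $\psi$ is $R$-linear on each fibre. These form the category $R\text{-}\mathsf{P`Shf'}$. For $U\in\mathcal{O}(X)$ the *profinite direct sum* $\boxplus_{u\in U}M_u$ is a profinite $R$-module with a continuous, fibrewise $R$-linear map $\omega\colon p^{-1}(U)\to\boxplus_{u\in U}M_u$ through which every continuous, fibrewise $R$-linear map from $p^{-1}(U)$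 to a profinite $R$-module factors by a unique continuous $R$-linear map. For a `sheaf' $\mathcal{M}$ put $\mathsf{CoShf}(\mathcal{M})(U)=\boxplus_{u\in U}M_u$, with the maps induced by the inclusions $p^{-1}(U)\subseteq p^{-1}(V)$; a morphism $(\psi,f)$ of `sheaves' is sent to $(\Psi,f)$, where $\Psi_{U,V}\colon\boxplus_{y\in f^{-1}(U)\cap V}N_y\to\boxplus_{u\in U}M_u$ is induced by $\psi$. For a cosheaf $\mathsf{M}$ put $$\mathsf{Co\acute{E}tale}(\mathsf{M})=\bigsqcup_{x\in X}M_x,\qquad M_x=\varprojlim_{U\ni x}\mathsf{M}(U),$$ with projections $\mathrm{cor}_x^U\colon M_x\to\mathsf{M}(U)$ and the topology generated by the sets $\{(m,x)\mid x\in U,\ \mathrm{cor}_x^U(m)\in W\}$ for $U\in\mathcal{O}(X)$ and $W\subseteq\mathsf{M}(U)$ open; a morphism $(\Psi,f)\colon(\mathsf{N},Y)\to(\mathsf{M},X)$ is sent to $(\psi,f)$, where $\psi$ is given on $N_y\to M_{f(y)}$ by the composites $N_y\to\mathsf{N}(f^{-1}(U))\xrightarrow{\Psi_{U,Y}}\mathsf{M}(U)$.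 **Theorem.** Each precosheaf $\mathsf{CoShf}(\mathcal{M})$ is a cosheaf, and these constructions are functors $$\mathsf{Co\acute{E}tale}\colon R\text{-}\mathsf{CoShf}\to R\text{-}\mathsf{P`Shf'},\qquad \mathsf{CoShf}\colon R\text{-}\mathsf{P`Shf'}\to R\text{-}\mathsf{CoShf}$$ which are mutually quasi-inverse, and so define an equivalence of categories. -/

import Mathlib

open CategoryTheory TopologicalSpace

universe u

namespace ProfSheaf

/-! ### Profinite modules -/

/-- A profinite left `R`-module: a topological `R`-module with (jointly) continuous action whose
underlying space is profinite, i.e. compact, Hausdorff and totally disconnected. -/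
structure PMod (R : Type u) [Ring R] [TopologicalSpace R] where
  carrier : Type u
  [addCommGroup : AddCommGroup carrier]
  [module : Module R carrier]
  [topologicalSpace : TopologicalSpace carrier]
  [isTopologicalAddGroup : IsTopologicalAddGroup carrier]
  [continuousSMul : ContinuousSMul R carrier]
  [compactSpace : CompactSpace carrier]
  [t2Space : T2Space carrier]
  [totallyDisconnectedSpace : TotallyDisconnectedSpace carrier]

attribute [instance] PMod.addCommGroup PMod.module PMod.topologicalSpace
  PMod.isTopologicalAddGroup PMod.continuousSMul PMod.compactSpace PMod.t2Space
  PMod.totallyDisconnectedSpace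

section

variable (R : Type u) [Ring R] [TopologicalSpace R]

instance : CoeSort (PMod R) (Type u) := ⟨PMod.carrier⟩

/-- The category of profinite `R`-modules and continuous `R`-linear maps. -/
instance : Category (PMod R) where
  Hom M N := M →L[R] N
  id M := ContinuousLinearMap.id R M
  comp f g := ContinuousLinearMap.comp g f

/-! ### Precosheaves and cosheaves -/

/-- The preimage of a clopen set under a continuous map. -/
def preim {Y X : Type u} [TopologicalSpace Y] [TopologicalSpace X] (f : C(Y, X))
    (U : Clopens X) : Clopens Y :=
  ⟨f ⁻¹' (U : Set X), U.isClopen.preimage f.continuous⟩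

theorem preim_mono {Y X : Type u} [TopologicalSpace Y] [TopologicalSpace X] (f : C(Y, X))
    {U U' : Clopens X} (h : U ≤ U') : preim f U ≤ preim f U' :=
  fun _ hy => h hy

theorem preim_id {X : Type u} [TopologicalSpace X] (U : Clopens X) :
    preim (ContinuousMap.id X) U = U :=
  rfl

theorem preim_comp {Z Y X : Type u} [TopologicalSpace Z] [TopologicalSpace Y] [TopologicalSpace X]
    (f : C(Y, X)) (g : C(Z, Y)) (U : Clopens X) : preim (f.comp g) U = preim g (preim f U) :=
  rfl

/-- A precosheaf of profinite `R`-modules `(M, X)`: a profinite space `X` and a covariant functor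
from the poset of compact open (equivalently clopen) subsets of `X` to profinite modules. -/
structure PreCoShf where
  X : Profinite.{u}
  F : Clopens X ⥤ PMod R

variable {R}

/-- The corestriction map `M(U) → M(V)` for `U ≤ V`. -/
def PreCoShf.cor (M : PreCoShf R) {U V : Clopens M.X} (h : U ≤ V) : M.F.obj U →L[R] M.F.obj V :=
  M.F.map (homOfLE h)

theorem PreCoShf.cor_self (M : PreCoShf R) {U : Clopens M.X} (h : U ≤ U) (a : M.F.obj U) :
    M.cor h a = a :=
  congrArg (fun φ : M.F.obj U →L[R] M.F.obj U => φ a) (M.F.map_id U)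

theorem PreCoShf.cor_cor (M : PreCoShf R) {U V W : Clopens M.X} (h : U ≤ V) (k : V ≤ W)
    (a : M.F.obj U) : M.cor k (M.cor h a) = M.cor (h.trans k) a :=
  (congrArg (fun φ : M.F.obj U →L[R] M.F.obj W => φ a)
    (M.F.map_comp (homOfLE h) (homOfLE k))).symm

/-- A morphism of precosheaves `(Ψ, f) : (N, Y) → (M, X)`: a continuous map `f : Y → X` and maps
`Ψ_{U,V} : N(f⁻¹(U) ∩ V) → M(U)` natural in the pair of clopen sets `U ⊆ X`, `V ⊆ Y`. -/
structure PreCoShf.Hom (N M : PreCoShf R) where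
  base : C(N.X, M.X)
  app : ∀ (U : Clopens M.X) (V : Clopens N.X), N.F.obj (preim base U ⊓ V) →L[R] M.F.obj U
  naturality : ∀ {U U' : Clopens M.X} {V V' : Clopens N.X} (hU : U ≤ U') (hV : V ≤ V')
    (a : N.F.obj (preim base U ⊓ V)),
    app U' V' (N.cor (inf_le_inf (preim_mono base hU) hV) a) = M.cor hU (app U V a)

theorem PreCoShf.Hom.ext' {N M : PreCoShf R} {φ ψ : PreCoShf.Hom N M} (h : φ.base = ψ.base)
    (h' : ∀ U V (hle : preim φ.base U ⊓ V ≤ preim ψ.base U ⊓ V) (a : N.F.obj (preim φ.base U ⊓ V)),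
      ψ.app U V (N.cor hle a) = φ.app U V a) : φ = ψ := by
  obtain ⟨f, p, hp⟩ := φ
  obtain ⟨g, q, hq⟩ := ψ
  obtain rfl : f = g := h
  congr 1
  funext U V
  ext a
  rw [← h' U V le_rfl a, N.cor_self]

/-- The identity morphism is given by the corestrictions `M(U ∩ V) → M(U)`. -/
def PreCoShf.Hom.id (M : PreCoShf R) : PreCoShf.Hom M M where
  base := ContinuousMap.id M.X
  app U V := M.cor (inf_le_left.trans (preim_id U).le)
  naturality hU hV a := by rw [M.cor_cor, M.cor_cor]

/-- The composite of `(Φ, g) : (P, Z) → (N, Y)` and `(Ψ, f) : (N, Y) → (M, X)` is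
`P((fg)⁻¹(U) ∩ V) = P(g⁻¹(f⁻¹(U)) ∩ V) → N(f⁻¹(U)) = N(f⁻¹(U) ∩ Y) → M(U)`. -/
def PreCoShf.Hom.comp {P N M : PreCoShf R} (Φ : PreCoShf.Hom P N) (Ψ : PreCoShf.Hom N M) :
    PreCoShf.Hom P M where
  base := Ψ.base.comp Φ.base
  app U V := (Ψ.app U ⊤).comp <| (N.cor (le_inf le_rfl le_top)).comp <|
    (Φ.app (preim Ψ.base U) V).comp <|
      P.cor (inf_le_inf_right V (preim_comp Ψ.base Φ.base U).le)
  naturality {U U' V V'} hU hV a := by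
    simp only [ContinuousLinearMap.comp_apply]
    have h1 := Φ.naturality (preim_mono Ψ.base hU) hV
      (P.cor (inf_le_inf_right V (preim_comp Ψ.base Φ.base U).le) a)
    have h2 := Ψ.naturality hU (le_refl (⊤ : Clopens N.X)) (N.cor (le_inf le_rfl le_top)
      (Φ.app (preim Ψ.base U) V (P.cor (inf_le_inf_right V (preim_comp Ψ.base Φ.base U).le) a)))
    rw [← h2, N.cor_cor, P.cor_cor]
    rw [P.cor_cor] at h1
    rw [h1, N.cor_cor]

/-- The category of precosheaves of profinite `R`-modules over varying profinite spaces. -/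
instance : Category (PreCoShf R) where
  Hom N M := PreCoShf.Hom N M
  id M := PreCoShf.Hom.id M
  comp Φ Ψ := PreCoShf.Hom.comp Φ Ψ
  id_comp {N M} Ψ := by
    refine PreCoShf.Hom.ext' rfl fun U V hle a => ?_
    have h := Ψ.naturality (le_refl U) (le_top : V ≤ ⊤) (N.cor hle a)
    rw [M.cor_self, N.cor_cor] at h
    refine h.symm.trans (congrArg (Ψ.app U ⊤) ?_)
    exact ((N.cor_cor _ _ _).trans (N.cor_cor _ _ _)).symm
  comp_id {N M} Ψ := by
    refine PreCoShf.Hom.ext' rfl fun U V hle a => ?_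
    have h := Ψ.naturality (preim_id U).le (le_refl V)
      (N.cor (hle.trans (inf_le_inf_right V (preim_mono Ψ.base (preim_id U).ge))) a)
    rw [N.cor_cor] at h
    exact h.trans (M.cor_cor _ _ _).symm
  assoc {Q P N M} Θ Φ Ψ := by
    refine PreCoShf.Hom.ext' rfl fun U V hle a => ?_
    have h := Θ.naturality (preim_comp Ψ.base Φ.base U).le (le_refl V)
      (Q.cor (hle.trans (inf_le_inf_right V (preim_comp (Ψ.base.comp Φ.base) Θ.base U).le)) a)
    rw [Q.cor_cor] at h
    refine congrArg (Ψ.app U ⊤) (congrArg (N.cor _) (congrArg (Φ.app (preim Ψ.base U) ⊤) ?_))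
    refine (P.cor_cor _ _ _).trans ((congrArg (P.cor _) (congrArg (Θ.app _ V)
      (Q.cor_cor _ _ _))).trans ?_)
    refine Eq.trans ?_ (congrArg (P.cor _) ((congrArg (Θ.app _ V) (Q.cor_cor _ _ _)).trans h).symm)
    exact (P.cor_cor _ _ _).symm

/-- The map `⨁_i M(U_i) → M(U_1 ∪ ⋯ ∪ U_n)`. -/
def PreCoShf.sumMap (M : PreCoShf R) {n : ℕ} (U : Fin n → Clopens M.X) :
    (∀ i, M.F.obj (U i)) →ₗ[R] M.F.obj (Finset.univ.sup U) :=
  ∑ i, (M.cor (Finset.le_sup (f := U) (Finset.mem_univ i))).toLinearMap ∘ₗ LinearMap.proj i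

/-- The map `p = ∑_{i,j} cor_{U_i ∩ U_j}^{U_i}`, from `⨁_{i,j} M(U_i ∩ U_j)` to `⨁_i M(U_i)`. -/
def PreCoShf.pMap (M : PreCoShf R) {n : ℕ} (U : Fin n → Clopens M.X) :
    (∀ ij : Fin n × Fin n, M.F.obj (U ij.1 ⊓ U ij.2)) →ₗ[R] ∀ i, M.F.obj (U i) :=
  ∑ ij : Fin n × Fin n, LinearMap.single R (fun i => (M.F.obj (U i) : Type u)) ij.1 ∘ₗ
    (M.cor (inf_le_left : U ij.1 ⊓ U ij.2 ≤ U ij.1)).toLinearMap ∘ₗ LinearMap.proj ij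

/-- The map `q = ∑_{i,j} cor_{U_i ∩ U_j}^{U_j}`, from `⨁_{i,j} M(U_i ∩ U_j)` to `⨁_i M(U_i)`. -/
def PreCoShf.qMap (M : PreCoShf R) {n : ℕ} (U : Fin n → Clopens M.X) :
    (∀ ij : Fin n × Fin n, M.F.obj (U ij.1 ⊓ U ij.2)) →ₗ[R] ∀ i, M.F.obj (U i) :=
  ∑ ij : Fin n × Fin n, LinearMap.single R (fun i => (M.F.obj (U i) : Type u)) ij.2 ∘ₗ
    (M.cor (inf_le_right : U ij.1 ⊓ U ij.2 ≤ U ij.2)).toLinearMap ∘ₗ LinearMap.proj ij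

variable (R)

/-- A precosheaf is a cosheaf if for every finite family of clopen sets (the empty family
included, which says `M(∅) = 0`) the sequence
`⨁_{i,j} M(U_i ∩ U_j) → ⨁_i M(U_i) → M(U_1 ∪ ⋯ ∪ U_n) → 0` is exact, the first map being
`p - q`. -/
def isCosheaf : ObjectProperty (PreCoShf R) := fun M =>
  ∀ (n : ℕ) (U : Fin n → Clopens M.X),
    Function.Exact (M.pMap U - M.qMap U) (M.sumMap U) ∧ Function.Surjective (M.sumMap U)

/-- The category of cosheaves of profinite `R`-modules, a full subcategory of precosheaves. -/
abbrev CoShf := (isCosheaf R).FullSubcategory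

/-! ### `Sheaves' of profinite modules -/

/-- The fibre of a map over a point. -/
abbrev Fibre {E X : Type u} (p : E → X) (x : X) : Type u := {m : E // p m = x}

/-- A `sheaf' of profinite `R`-modules `(M, p, X)`: a continuous surjection `p : M → X` of profinite
spaces together with `R`-module structures on the fibres such that the maps `R × M → M` and
`M ×_X M → M` given by scalar multiplication and addition are continuous. (The fibres are
then profinite `R`-modules in the subspace topology.) -/
structure PShf where
  X : Profinite.{u}
  total : Profinite.{u}
  p : C(total, X)
  surjective : Function.Surjective p
  [addCommGroup : ∀ x, AddCommGroup (Fibre p x)]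
  [module : ∀ x, Module R (Fibre p x)]
  continuous_smul : Continuous fun z : R × total => (z.1 • (⟨z.2, rfl⟩ : Fibre p (p z.2))).1
  continuous_add : Continuous fun z : {z : total × total // p z.1 = p z.2} =>
    ((⟨z.1.1, z.2⟩ : Fibre p (p z.1.2)) + ⟨z.1.2, rfl⟩).1

attribute [instance] PShf.addCommGroup PShf.module

/-- The map `N_y → M_{f(y)}` on fibres induced by `ψ : N → M` lying over `f : Y → X`. -/
def Fibre.map {E X E' X' : Type u} {p : E → X} {p' : E' → X'} {ψ : E → E'} {f : X → X'}
    (h : ∀ m, p' (ψ m) = f (p m)) (x : X) (a : Fibre p x) : Fibre p' (f x) :=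
  ⟨ψ a.1, (h a.1).trans (congrArg f a.2)⟩

variable {R}

/-- A morphism of `sheaves' `(ψ, f)`: continuous maps `ψ` of total spaces and `f` of base spaces
that commute with the projections, such that `ψ` is `R`-linear on each fibre. -/
structure PShf.Hom (N M : PShf R) where
  base : C(N.X, M.X)
  map : C(N.total, M.total)
  comm : ∀ m, M.p (map m) = base (N.p m)
  map_add : ∀ y (a b : Fibre N.p y),
    Fibre.map comm y (a + b) = Fibre.map comm y a + Fibre.map comm y b
  map_smul : ∀ y (r : R) (a : Fibre N.p y), Fibre.map comm y (r • a) = r • Fibre.map comm y a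

theorem PShf.Hom.ext' {N M : PShf R} {φ ψ : PShf.Hom N M} (h : φ.base = ψ.base)
    (h' : φ.map = ψ.map) : φ = ψ := by
  cases φ; cases ψ; cases h; cases h'; rfl

/-- The category of `sheaves' of profinite `R`-modules. -/
instance : Category (PShf R) where
  Hom N M := PShf.Hom N M
  id M :=
    { base := ContinuousMap.id _
      map := ContinuousMap.id _
      comm := fun _ => rfl
      map_add := fun _ _ _ => rfl
      map_smul := fun _ _ _ => rfl }
  comp {P N M} φ ψ :=
    { base := ψ.base.comp φ.base
      map := ψ.map.comp φ.map
      comm := fun m => (ψ.comm _).trans (congrArg ψ.base (φ.comm m))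
      map_add := fun y a b => by
        have h1 := φ.map_add y a b
        have h2 := ψ.map_add _ (Fibre.map φ.comm y a) (Fibre.map φ.comm y b)
        rw [← h1] at h2
        exact h2
      map_smul := fun y r a => by
        have h1 := φ.map_smul y r a
        have h2 := ψ.map_smul _ r (Fibre.map φ.comm y a)
        rw [← h1] at h2
        exact h2 }

/-! ### Profinite direct sums and the functor to cosheaves -/

/-- The total space `p⁻¹(U)` of the restriction of a `sheaf' to a clopen set `U`. -/
abbrev PShf.Over (M : PShf R) (U : Clopens M.X) : Type u := {m : M.total // M.p m ∈ U}

/-- A point of the fibre over `x ∈ U`, as a point of `p⁻¹(U)`. -/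
def PShf.toOver (M : PShf R) {U : Clopens M.X} {x : M.X} (hx : x ∈ U) (a : Fibre M.p x) :
    M.Over U :=
  ⟨a.1, by rw [a.2]; exact hx⟩

/-- A `sheaf' morphism from the restriction of the `sheaf' `M` to the clopen set `U` to a profinite
`R`-module `P`, viewed as a `sheaf' over a point: a continuous map `p⁻¹(U) → P` that is `R`-linear
on each fibre. -/
@[ext]
structure PShf.HomOver (M : PShf R) (U : Clopens M.X) (P : PMod R) where
  toMap : C(M.Over U, P)
  map_add : ∀ x (hx : x ∈ U) (a b : Fibre M.p x),
    toMap (M.toOver hx (a + b)) = toMap (M.toOver hx a) + toMap (M.toOver hx b)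
  map_smul : ∀ x (hx : x ∈ U) (r : R) (a : Fibre M.p x),
    toMap (M.toOver hx (r • a)) = r • toMap (M.toOver hx a)

/-- The universal property of the profinite direct sum of the `sheaf' `M` restricted to `U`:
`ω : p⁻¹(U) → D` is universal among `sheaf' morphisms to profinite `R`-modules. -/
def PShf.IsDirectSum (M : PShf R) (U : Clopens M.X) (D : PMod R) (ω : M.HomOver U D) : Prop :=
  ∀ (P : PMod R) (β : M.HomOver U P), ∃! φ : D →L[R] P, ∀ m, φ (ω.toMap m) = β.toMap m

/-- A continuous linear map applied after a `sheaf' morphism to a module. -/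
def PShf.HomOver.postcomp {M : PShf R} {U : Clopens M.X} {P Q : PMod R} (β : M.HomOver U P)
    (φ : P →L[R] Q) : M.HomOver U Q where
  toMap := (φ : C(P, Q)).comp β.toMap
  map_add x hx a b := (congrArg φ (β.map_add x hx a b)).trans (_root_.map_add φ _ _)
  map_smul x hx r a := (congrArg φ (β.map_smul x hx r a)).trans (_root_.map_smul φ _ _)

/-- The profinite module given by a closed submodule. -/
def PMod.ofClosed {P : Type u} [AddCommGroup P] [Module R P] [TopologicalSpace P]
    [IsTopologicalAddGroup P] [ContinuousSMul R P] [CompactSpace P] [T2Space P]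
    [TotallyDisconnectedSpace P] (W : Submodule R P) (hW : IsClosed (W : Set P)) : PMod R :=
  haveI : CompactSpace W := isCompact_iff_compactSpace.mp hW.isCompact
  { carrier := W }

/-- The profinite module structure transported along a bijection. -/
def PMod.transport {A : Type u} (P : PMod R) (e : A ≃ P) : PMod R :=
  letI := e.addCommGroup
  letI := e.module R
  letI : TopologicalSpace A := TopologicalSpace.induced e inferInstance
  let h : A ≃ₜ P := e.toHomeomorphOfIsInducing ⟨rfl⟩
  haveI : CompactSpace A := h.symm.compactSpace
  haveI : T2Space A := h.symm.t2Space
  haveI : TotallyDisconnectedSpace A := h.symm.totallyDisconnectedSpace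
  haveI : IsTopologicalAddGroup A :=
    { continuous_add := by
        refine continuous_induced_rng.mpr ?_
        have : (e ∘ fun z : A × A => z.1 + z.2) = fun z => e z.1 + e z.2 := by
          funext z; exact e.apply_symm_apply _
        rw [this]
        exact (h.continuous.comp continuous_fst).add (h.continuous.comp continuous_snd)
      continuous_neg := by
        refine continuous_induced_rng.mpr ?_
        have : (e ∘ fun z : A => -z) = fun z => -e z := by
          funext z; exact e.apply_symm_apply _
        rw [this]
        exact h.continuous.neg }
  haveI : ContinuousSMul R A := ⟨by
    refine continuous_induced_rng.mpr ?_
    have : (e ∘ fun z : R × A => z.1 • z.2) = fun z => z.1 • e z.2 := by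
      funext z; exact e.apply_symm_apply _
    rw [this]
    exact continuous_fst.smul (h.continuous.comp continuous_snd)⟩
  { carrier := A }

/-- The transported module is isomorphic to the original one. -/
def PMod.transportEquiv {A : Type u} (P : PMod R) (e : A ≃ P) : (P.transport e) ≃L[R] P where
  toFun := e
  invFun := e.symm
  left_inv := e.left_inv
  right_inv := e.right_inv
  map_add' _ _ := e.apply_symm_apply _
  map_smul' _ _ := e.apply_symm_apply _
  continuous_toFun := continuous_induced_dom
  continuous_invFun := (e.toHomeomorphOfIsInducing (Y := P) (X := P.transport e) ⟨rfl⟩).symm.continuous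

/-- A Hausdorff space with a dense subset indexed by `D` has at most `2 ^ 2 ^ |D|` points. -/
theorem exists_injective_of_dense {D Y : Type u} [TopologicalSpace Y] [T2Space Y] (b : D → Y)
    (hb : DenseRange b) : ∃ ι : Y → Set (Set D), Function.Injective ι := by
  refine ⟨fun y => {S | ∃ V ∈ nhds y, b ⁻¹' V = S}, fun y y' h => ?_⟩
  by_contra hne
  obtain ⟨V, V', hV, hV', hd⟩ := t2_separation_nhds hne
  obtain ⟨W, hW, hWV⟩ : b ⁻¹' V ∈ {S | ∃ V ∈ nhds y', b ⁻¹' V = S} := by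
    change _ ∈ (fun y => {S | ∃ V ∈ nhds y, b ⁻¹' V = S}) y'
    rw [← h]
    exact ⟨V, hV, rfl⟩
  obtain ⟨z, ⟨d, rfl⟩, hz, hz'⟩ := hb.inter_nhds_nonempty (Filter.inter_mem hW hV')
  have hzV : d ∈ b ⁻¹' V := by rw [← hWV]; exact hz
  exact Set.disjoint_left.mp hd hzV hz'

/-- Module structures on a type `A` making it a profinite module, as a `u`-small type. -/
structure PMod.Str (R : Type u) [Ring R] [TopologicalSpace R] (A : Type u) : Type u where
  [addCommGroup : AddCommGroup A]
  [module : Module R A]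
  [topologicalSpace : TopologicalSpace A]
  [isTopologicalAddGroup : IsTopologicalAddGroup A]
  [continuousSMul : ContinuousSMul R A]
  [compactSpace : CompactSpace A]
  [t2Space : T2Space A]
  [totallyDisconnectedSpace : TotallyDisconnectedSpace A]

/-- The profinite module given by a structure on `A`. -/
def PMod.Str.toPMod {A : Type u} (σ : PMod.Str R A) : PMod R :=
  { σ with carrier := A }

theorem PShf.exists_isDirectSum (M : PShf R) (U : Clopens M.X) :
    ∃ (D : PMod R) (ω : M.HomOver U D), M.IsDirectSum U D ω := by
  let D₀ : Type u := M.Over U →₀ R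
  let I : Type u := Σ (A : Set (Set (Set D₀))) (σ : PMod.Str R A), M.HomOver U σ.toPMod
  let T : I → PMod R := fun i => i.2.1.toPMod
  let ω₀ : C(M.Over U, ∀ i, T i) :=
    ⟨fun m i => i.2.2.toMap m, continuous_pi fun i => i.2.2.toMap.continuous⟩
  let W : Submodule R (∀ i, T i) := (Submodule.span R (Set.range ω₀)).topologicalClosure
  have hW : ∀ m, ω₀ m ∈ W := fun m =>
    Submodule.le_topologicalClosure _ (Submodule.subset_span ⟨m, rfl⟩)
  let D : PMod R := PMod.ofClosed W (Submodule.isClosed_topologicalClosure _)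
  let ω : M.HomOver U D :=
    { toMap := ⟨fun m => ⟨ω₀ m, hW m⟩, ω₀.continuous.subtype_mk _⟩
      map_add := fun x hx a b => Subtype.ext (funext fun i => i.2.2.map_add x hx a b)
      map_smul := fun x hx r a => Subtype.ext (funext fun i => i.2.2.map_smul x hx r a) }
  refine ⟨D, ω, fun P β => ?_⟩
  refine existsUnique_of_exists_of_unique ?_ ?_
  · let V : Submodule R P := (Submodule.span R (Set.range β.toMap)).topologicalClosure
    have hV : ∀ m, β.toMap m ∈ V := fun m =>
      Submodule.le_topologicalClosure _ (Submodule.subset_span ⟨m, rfl⟩)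
    let Q : PMod R := PMod.ofClosed V (Submodule.isClosed_topologicalClosure _)
    have hb : ∀ d : D₀, Finsupp.linearCombination R β.toMap d ∈ V := fun d =>
      Submodule.le_topologicalClosure _ (by
        rw [← Finsupp.range_linearCombination]; exact ⟨d, rfl⟩)
    let b : D₀ → Q := fun d => ⟨Finsupp.linearCombination R β.toMap d, hb d⟩
    have hdense : DenseRange b := by
      intro y
      change V at y
      refine closure_subtype.mpr ?_
      have hy : y.1 ∈ closure (Submodule.span R (Set.range β.toMap) : Set P) := y.2
      refine closure_mono ?_ hy
      rw [← Finsupp.range_linearCombination]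
      rintro _ ⟨d, rfl⟩
      exact ⟨_, ⟨d, rfl⟩, rfl⟩
    obtain ⟨ι, hι⟩ := exists_injective_of_dense b hdense
    let e : Set.range ι ≃ Q := (Equiv.ofInjective ι hι).symm
    let Q' : PMod R := Q.transport e
    let ε : Q' ≃L[R] Q := Q.transportEquiv e
    let βQ : M.HomOver U Q :=
      { toMap := ⟨fun m => ⟨β.toMap m, hV m⟩, β.toMap.continuous.subtype_mk _⟩
        map_add := fun x hx a b => Subtype.ext (β.map_add x hx a b)
        map_smul := fun x hx r a => Subtype.ext (β.map_smul x hx r a) }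
    let σ : PMod.Str R (Set.range ι) :=
      { addCommGroup := Q'.addCommGroup
        module := Q'.module
        topologicalSpace := Q'.topologicalSpace
        isTopologicalAddGroup := Q'.isTopologicalAddGroup
        continuousSMul := Q'.continuousSMul
        compactSpace := Q'.compactSpace
        t2Space := Q'.t2Space
        totallyDisconnectedSpace := Q'.totallyDisconnectedSpace }
    let i : I := ⟨Set.range ι, σ, βQ.postcomp (Q := Q') ε.symm.toContinuousLinearMap⟩
    let π : D →L[R] Q' := (ContinuousLinearMap.proj (φ := fun i => T i) i).comp W.subtypeL
    let κ : Q →L[R] P := V.subtypeL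
    refine ⟨κ.comp (ε.toContinuousLinearMap.comp π), fun m => ?_⟩
    exact congrArg κ (ε.apply_symm_apply (βQ.toMap m))
  · intro φ ψ hφ hψ
    have hD : ∀ d : D, (d : D) ∈ closure (Submodule.span R (Set.range ω.toMap) : Set D) := by
      intro d
      change W at d
      refine closure_subtype.mpr ?_
      have hd : d.1 ∈ closure (Submodule.span R (Set.range ω₀) : Set (∀ i, T i)) := d.2
      refine closure_mono ?_ hd
      have h2 : (Submodule.span R (Set.range fun m => (⟨ω₀ m, hW m⟩ : W))).map W.subtype =
          Submodule.span R (Set.range ω₀) := by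
        rw [Submodule.map_span, ← Set.range_comp]; rfl
      intro z hz
      rw [← h2] at hz
      obtain ⟨y, hy, rfl⟩ := hz
      exact ⟨y, hy, rfl⟩
    ext d
    have hsub : (Submodule.span R (Set.range ω.toMap) : Set D) ⊆ {d | φ d = ψ d} := by
      have : Submodule.span R (Set.range ω.toMap) ≤
          LinearMap.eqLocus φ.toLinearMap ψ.toLinearMap := by
        rw [Submodule.span_le]
        rintro _ ⟨m, rfl⟩
        exact (hφ m).trans (hψ m).symm
      exact this
    exact closure_minimal hsub (isClosed_eq φ.continuous ψ.continuous) (hD d)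

/-- The profinite direct sum `⊞_{u ∈ U} M_u`, chosen by its universal property. -/
noncomputable def PShf.directSum (M : PShf R) (U : Clopens M.X) : PMod R :=
  (M.exists_isDirectSum U).choose

/-- The canonical morphism `ω : p⁻¹(U) → ⊞_{u ∈ U} M_u`. -/
noncomputable def PShf.omega (M : PShf R) (U : Clopens M.X) : M.HomOver U (M.directSum U) :=
  (M.exists_isDirectSum U).choose_spec.choose

theorem PShf.isDirectSum (M : PShf R) (U : Clopens M.X) :
    M.IsDirectSum U (M.directSum U) (M.omega U) :=
  (M.exists_isDirectSum U).choose_spec.choose_spec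

/-- The map out of the profinite direct sum induced by a `sheaf' morphism. -/
noncomputable def PShf.lift (M : PShf R) {U : Clopens M.X} {P : PMod R} (β : M.HomOver U P) :
    M.directSum U →L[R] P :=
  (M.isDirectSum U P β).choose

theorem PShf.lift_omega (M : PShf R) {U : Clopens M.X} {P : PMod R} (β : M.HomOver U P)
    (m : M.Over U) : M.lift β ((M.omega U).toMap m) = β.toMap m :=
  (M.isDirectSum U P β).choose_spec.1 m

theorem PShf.directSum_ext (M : PShf R) {U : Clopens M.X} {P : PMod R}
    {φ ψ : M.directSum U →L[R] P}
    (h : ∀ m, φ ((M.omega U).toMap m) = ψ ((M.omega U).toMap m)) : φ = ψ :=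
  (M.isDirectSum U P ((M.omega U).postcomp ψ)).unique h fun _ => rfl

theorem PShf.Hom.mem_of_le {N M : PShf R} (φ : PShf.Hom N M) {V : Clopens N.X} {U : Clopens M.X}
    (h : V ≤ preim φ.base U) (m : N.Over V) : M.p (φ.map m.1) ∈ U := by
  rw [φ.comm]; exact h m.2

/-- The map `q⁻¹(V) → p⁻¹(U)` induced by a morphism `(ψ, f) : (N, q, Y) → (M, p, X)` of `sheaves'
when `V ⊆ f⁻¹(U)`. -/
def PShf.Hom.mapOver {N M : PShf R} (φ : PShf.Hom N M) {V : Clopens N.X} {U : Clopens M.X}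
    (h : V ≤ preim φ.base U) : C(N.Over V, M.Over U) where
  toFun m := ⟨φ.map m.1, φ.mem_of_le h m⟩
  continuous_toFun := (φ.map.continuous.comp continuous_subtype_val).subtype_mk _

/-- The composite of a `sheaf' morphism `M|_U → P` with the `sheaf' morphism `N|_V → M|_U` induced
by `(ψ, f) : N → M` when `V ⊆ f⁻¹(U)`. -/
def PShf.HomOver.precomp {N M : PShf R} {U : Clopens M.X} {P : PMod R} (β : M.HomOver U P)
    (φ : PShf.Hom N M) {V : Clopens N.X} (h : V ≤ preim φ.base U) : N.HomOver V P where
  toMap := β.toMap.comp (φ.mapOver h)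
  map_add y hy a b := by
    have := β.map_add _ (h hy) (Fibre.map φ.comm y a) (Fibre.map φ.comm y b)
    rw [← φ.map_add] at this
    exact this
  map_smul y hy r a := by
    have := β.map_smul _ (h hy) r (Fibre.map φ.comm y a)
    rw [← φ.map_smul] at this
    exact this

/-- The map `⊞_{y ∈ V} N_y → ⊞_{u ∈ U} M_u` induced by a morphism `(ψ, f) : N → M` of `sheaves'
and clopen sets with `V ⊆ f⁻¹(U)`. -/
noncomputable def PShf.sumHom {N M : PShf R} (φ : PShf.Hom N M) {V : Clopens N.X}
    {U : Clopens M.X} (h : V ≤ preim φ.base U) : N.directSum V →L[R] M.directSum U :=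
  N.lift ((M.omega U).precomp φ h)

theorem PShf.sumHom_omega {N M : PShf R} (φ : PShf.Hom N M) {V : Clopens N.X} {U : Clopens M.X}
    (h : V ≤ preim φ.base U) (m : N.Over V) :
    PShf.sumHom φ h ((N.omega V).toMap m) = (M.omega U).toMap (φ.mapOver h m) :=
  N.lift_omega _ m

theorem PShf.sumHom_comp {P N M : PShf R} (φ : PShf.Hom P N) (ψ : PShf.Hom N M)
    (χ : PShf.Hom P M) (hχ : ∀ m, ψ.map (φ.map m) = χ.map m) {W : Clopens P.X}
    {V : Clopens N.X} {U : Clopens M.X} (h : W ≤ preim φ.base V)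
    (k : V ≤ preim ψ.base U) (l : W ≤ preim χ.base U) (a : P.directSum W) :
    PShf.sumHom ψ k (PShf.sumHom φ h a) = PShf.sumHom χ l a := by
  have : (PShf.sumHom ψ k).comp (PShf.sumHom φ h) = PShf.sumHom χ l := by
    refine P.directSum_ext fun m => ?_
    rw [ContinuousLinearMap.comp_apply, PShf.sumHom_omega, PShf.sumHom_omega, PShf.sumHom_omega]
    exact congrArg _ (Subtype.ext (hχ m.1))
  exact congrArg (fun φ => φ a) this

theorem PShf.sumHom_id (M : PShf R) {U : Clopens M.X} (h : U ≤ preim (PShf.Hom.base (𝟙 M)) U) :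
    PShf.sumHom (𝟙 M) h = ContinuousLinearMap.id R (M.directSum U) := by
  refine M.directSum_ext fun m => ?_
  rw [PShf.sumHom_omega]
  rfl

/-- The precosheaf `U ↦ ⊞_{u ∈ U} M_u` of a `sheaf' `M`; its corestriction maps are induced by the
inclusions `p⁻¹(U) ⊆ p⁻¹(V)`. -/
noncomputable def PShf.toPreCoShf (M : PShf R) : PreCoShf R where
  X := M.X
  F :=
    { obj := fun U => M.directSum U
      map := fun {U V} h => PShf.sumHom (𝟙 M) (V := U) (U := V) h.le
      map_id := fun U => M.sumHom_id _
      map_comp := fun {U V W} h k => by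
        refine ContinuousLinearMap.ext fun a => ?_
        exact (PShf.sumHom_comp (𝟙 M) (𝟙 M) (𝟙 M) (fun _ => rfl) h.le k.le (h ≫ k).le a).symm }

/-- The morphism of precosheaves `(Ψ, f)` induced by a morphism `(ψ, f)` of `sheaves'. -/
noncomputable def PShf.Hom.toPreCoShf {N M : PShf R} (φ : PShf.Hom N M) :
    PreCoShf.Hom N.toPreCoShf M.toPreCoShf where
  base := φ.base
  app U V := PShf.sumHom (V := preim φ.base U ⊓ V) φ inf_le_left
  naturality {U U' V V'} hU hV a := by
    have h1 := PShf.sumHom_comp (𝟙 N) φ φ (fun _ => rfl) (V := preim φ.base U' ⊓ V') (U := U')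
      (W := preim φ.base U ⊓ V) (inf_le_inf (preim_mono _ hU) hV) inf_le_left
      (inf_le_left.trans (preim_mono _ hU)) a
    have h2 := PShf.sumHom_comp φ (𝟙 M) φ (fun _ => rfl) (V := U) (U := U')
      (W := preim φ.base U ⊓ V) inf_le_left hU (inf_le_left.trans (preim_mono _ hU)) a
    exact h1.trans h2.symm

variable (R) in
/-- The functor `CoShf`, with values in precosheaves: `CoShf(M)(U) = ⊞_{u ∈ U} M_u`, and a morphism
`(ψ, f) : N → M` is sent to `(Ψ, f)` with
`Ψ_{U,V} : ⊞_{y ∈ f⁻¹(U) ∩ V} N_y → ⊞_{u ∈ U} M_u` induced by `ψ`. -/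
noncomputable def coShf : PShf R ⥤ PreCoShf R where
  obj M := M.toPreCoShf
  map φ := PShf.Hom.toPreCoShf φ
  map_id M := by
    refine PreCoShf.Hom.ext' rfl fun U V hle a => ?_
    have hU : preim (ContinuousMap.id M.X) U ⊓ V ≤ U := inf_le_left.trans (preim_id U).le
    exact PShf.sumHom_comp (𝟙 M) (𝟙 M) (𝟙 M) (fun _ => rfl) hle hU hU a
  map_comp {P N M} φ ψ := by
    refine PreCoShf.Hom.ext' rfl fun U V hle a => ?_
    let Φ : PShf.Hom P N := φ
    let Ψ : PShf.Hom N M := ψ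
    have h0 : preim (Ψ.base.comp Φ.base) U ⊓ V ≤ preim Φ.base (preim Ψ.base U) ⊓ V := fun _ h => h
    have h1 : preim (Ψ.base.comp Φ.base) U ⊓ V ≤ preim Φ.base (preim Ψ.base U) := fun _ h => h.1
    have h2 : preim (Ψ.base.comp Φ.base) U ⊓ V ≤ preim Φ.base (preim Ψ.base U ⊓ ⊤) :=
      fun _ h => ⟨h.1, trivial⟩
    have e1 := PShf.sumHom_comp (𝟙 P) (𝟙 P) (𝟙 P) (fun _ => rfl)
      (V := preim (Ψ.base.comp Φ.base) U ⊓ V) (U := preim Φ.base (preim Ψ.base U) ⊓ V)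
      (W := preim (Ψ.base.comp Φ.base) U ⊓ V) hle h0 h0 a
    have e2 := PShf.sumHom_comp (𝟙 P) Φ Φ (fun _ => rfl)
      (V := preim Φ.base (preim Ψ.base U) ⊓ V) (U := preim Ψ.base U)
      (W := preim (Ψ.base.comp Φ.base) U ⊓ V) h0 inf_le_left h1 a
    have e3 := PShf.sumHom_comp Φ (𝟙 N) Φ (fun _ => rfl)
      (V := preim Ψ.base U) (U := preim Ψ.base U ⊓ ⊤)
      (W := preim (Ψ.base.comp Φ.base) U ⊓ V) h1 (le_inf le_rfl le_top) h2 a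
    have e4 := PShf.sumHom_comp Φ Ψ (φ ≫ ψ) (fun _ => rfl)
      (V := preim Ψ.base U ⊓ ⊤) (U := U)
      (W := preim (Ψ.base.comp Φ.base) U ⊓ V) h2 inf_le_left inf_le_left a
    rw [← e3, ← e2, ← e1] at e4
    exact e4


/-! ### Stalks and the co-étale construction -/

/-- The stalk `M_x = lim M(U)`, the inverse limit over the clopen sets `U` containing `x`. -/
def PreCoShf.stalk (M : PreCoShf R) (x : M.X) :
    Submodule R (∀ U : {U : Clopens M.X // x ∈ U}, M.F.obj U.1) where
  carrier := {s | ∀ (U V : {U : Clopens M.X // x ∈ U}) (h : U.1 ≤ V.1), M.cor h (s U) = s V}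
  add_mem' {a b} ha hb U V h := by
    simp only [Pi.add_apply, map_add, ha U V h, hb U V h]
  zero_mem' U V h := by simp only [Pi.zero_apply, map_zero]
  smul_mem' r a ha U V h := by simp only [Pi.smul_apply, map_smul, ha U V h]

/-- The disjoint union of the stalks of a precosheaf. -/
structure PreCoShf.Total (M : PreCoShf R) : Type u where
  pt : M.X
  val : M.stalk pt

/-- The sub-basic set `O_{U,W}` of all `(m, x)` such that `x ∈ U` and `cor_x^U(m) ∈ W`. -/
def PreCoShf.basicOpen (M : PreCoShf R) (U : Clopens M.X) (W : Set (M.F.obj U)) : Set M.Total :=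
  {m | ∃ h : m.pt ∈ U, m.val.1 ⟨U, h⟩ ∈ W}

/-- The topology generated by the sets `O_{U,W}` with `U` clopen and `W ⊆ M(U)` open. -/
instance (M : PreCoShf R) : TopologicalSpace M.Total :=
  TopologicalSpace.generateFrom
    {O | ∃ (U : Clopens M.X) (W : Set (M.F.obj U)), IsOpen W ∧ O = M.basicOpen U W}

theorem PreCoShf.isOpen_basicOpen (M : PreCoShf R) (U : Clopens M.X) {W : Set (M.F.obj U)}
    (hW : IsOpen W) : IsOpen (M.basicOpen U W) :=
  TopologicalSpace.isOpen_generateFrom_of_mem ⟨U, W, hW, rfl⟩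

open scoped Classical in
/-- The component at `U` of the embedding `i`: `cor_x^U(m)` if `x ∈ U`, and `0` otherwise. -/
noncomputable def PreCoShf.ev (M : PreCoShf R) (U : Clopens M.X) (m : M.Total) : M.F.obj U :=
  if h : m.pt ∈ U then m.val.1 ⟨U, h⟩ else 0

theorem PreCoShf.ev_of_mem (M : PreCoShf R) {U : Clopens M.X} {m : M.Total} (h : m.pt ∈ U) :
    M.ev U m = m.val.1 ⟨U, h⟩ := dif_pos h

theorem PreCoShf.ev_of_notMem (M : PreCoShf R) {U : Clopens M.X} {m : M.Total} (h : m.pt ∉ U) :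
    M.ev U m = 0 := dif_neg h

/-- The embedding `i` of the disjoint union of the stalks into `∏_U M(U) × X`. -/
noncomputable def PreCoShf.emb (M : PreCoShf R) (m : M.Total) : (∀ U, M.F.obj U) × M.X :=
  (fun U => M.ev U m, m.pt)

theorem PreCoShf.emb_injective (M : PreCoShf R) : Function.Injective M.emb := by
  rintro ⟨x, s⟩ ⟨y, t⟩ h
  obtain rfl : x = y := congrArg Prod.snd h
  congr 1
  refine Subtype.ext (funext fun U => ?_)
  have := congrFun (congrArg Prod.fst h) U.1
  change M.ev U.1 ⟨x, s⟩ = M.ev U.1 ⟨x, t⟩ at this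
  rwa [M.ev_of_mem (m := ⟨x, s⟩) U.2, M.ev_of_mem (m := ⟨x, t⟩) U.2] at this

theorem PreCoShf.continuous_pt (M : PreCoShf R) : Continuous (PreCoShf.Total.pt (M := M)) := by
  refine (isTopologicalBasis_isClopen (X := M.X)).continuous_iff.mpr fun U hU => ?_
  convert M.isOpen_basicOpen ⟨U, hU⟩ isOpen_univ using 1
  ext m
  exact ⟨fun h => ⟨h, trivial⟩, fun h => h.1⟩

theorem PreCoShf.isInducing_emb (M : PreCoShf R) : Topology.IsInducing M.emb := by
  refine ⟨le_antisymm ?_ (le_generateFrom ?_)⟩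
  · refine continuous_iff_le_induced.mp (Continuous.prodMk (continuous_pi fun U => ?_)
      M.continuous_pt)
    refine continuous_def.mpr fun W hW => ?_
    by_cases h0 : (0 : M.F.obj U) ∈ W
    · convert (M.isOpen_basicOpen U hW).union (M.isOpen_basicOpen Uᶜ isOpen_univ) using 1
      ext m
      by_cases h : m.pt ∈ U
      · have h' : m.pt ∉ Uᶜ := fun h' => h' h
        simp [PreCoShf.basicOpen, M.ev_of_mem h, h, h']
      · have h' : m.pt ∈ Uᶜ := h
        simp [PreCoShf.basicOpen, M.ev_of_notMem h, h, h', h0]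
    · convert M.isOpen_basicOpen U hW using 1
      ext m
      by_cases h : m.pt ∈ U
      · simp [PreCoShf.basicOpen, M.ev_of_mem h, h]
      · simp [PreCoShf.basicOpen, M.ev_of_notMem h, h, h0]
  · rintro _ ⟨U, W, hW, rfl⟩
    refine isOpen_induced_iff.mpr ⟨{z | z.2 ∈ U ∧ z.1 U ∈ W}, ?_, ?_⟩
    · exact (U.isOpen.preimage continuous_snd).inter
        (hW.preimage ((continuous_apply U).comp continuous_fst))
    · ext m
      constructor
      · rintro ⟨h, h'⟩
        refine ⟨h, ?_⟩
        rw [← M.ev_of_mem h]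
        exact h'
      · rintro ⟨h, h'⟩
        refine ⟨h, ?_⟩
        change M.ev U m ∈ W
        rwa [M.ev_of_mem h]

theorem PreCoShf.range_emb (M : PreCoShf R) : Set.range M.emb =
    (⋂ U : Clopens M.X, {z | z.2 ∈ U ∨ z.1 U = 0}) ∩
      ⋂ (U : Clopens M.X) (V : Clopens M.X) (h : U ≤ V), {z | z.2 ∉ U ∨ M.cor h (z.1 U) = z.1 V} := by
  ext ⟨s, x⟩
  simp only [Set.mem_range, Set.mem_inter_iff, Set.mem_iInter, Set.mem_ofPred_eq]
  constructor
  · rintro ⟨m, hm⟩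
    obtain rfl : m.pt = x := congrArg Prod.snd hm
    obtain rfl : (fun U => M.ev U m) = s := congrArg Prod.fst hm
    refine ⟨fun U => ?_, fun U V h => ?_⟩
    · by_cases hU : m.pt ∈ U
      · exact Or.inl hU
      · exact Or.inr (M.ev_of_notMem hU)
    · by_cases hU : m.pt ∈ U
      · right
        change M.cor h (M.ev U m) = M.ev V m
        rw [M.ev_of_mem hU, M.ev_of_mem (h hU)]
        exact m.val.2 ⟨U, hU⟩ ⟨V, h hU⟩ h
      · exact Or.inl hU
  · rintro ⟨h1, h2⟩
    let m : M.Total := ⟨x, ⟨fun U => s U.1, fun U V h => (h2 U.1 V.1 h).resolve_left (not_not.mpr U.2)⟩⟩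
    refine ⟨m, Prod.ext (funext fun U => ?_) rfl⟩
    by_cases hU : x ∈ U
    · exact M.ev_of_mem (m := m) hU
    · exact (M.ev_of_notMem (m := m) hU).trans ((h1 U).resolve_left hU).symm

theorem PreCoShf.isClosedEmbedding_emb (M : PreCoShf R) : Topology.IsClosedEmbedding M.emb := by
  refine ⟨⟨M.isInducing_emb, M.emb_injective⟩, ?_⟩
  rw [M.range_emb]
  refine (isClosed_iInter fun U => ?_).inter
    (isClosed_iInter fun U => isClosed_iInter fun V => isClosed_iInter fun h => ?_)
  · exact (U.isClosed.preimage continuous_snd).union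
      (isClosed_singleton.preimage ((continuous_apply U).comp continuous_fst))
  · exact (U.isOpen.isClosed_compl.preimage continuous_snd).union
      (isClosed_eq ((M.cor h).continuous.comp ((continuous_apply U).comp continuous_fst))
        ((continuous_apply V).comp continuous_fst))

instance (M : PreCoShf R) : CompactSpace M.Total := M.isClosedEmbedding_emb.compactSpace

instance (M : PreCoShf R) : T2Space M.Total := M.isClosedEmbedding_emb.isEmbedding.t2Space

instance (M : PreCoShf R) : TotallyDisconnectedSpace M.Total :=
  M.isClosedEmbedding_emb.isEmbedding.isTotallyDisconnected_range.mp
    (isTotallyDisconnected_of_totallyDisconnectedSpace _)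

/-- The fibre of `⨆_x M_x → X` over `x` is the stalk `M_x`. -/
def PreCoShf.fibreEquiv (M : PreCoShf R) (x : M.X) :
    Fibre (PreCoShf.Total.pt (M := M)) x ≃ M.stalk x where
  toFun m := m.2 ▸ m.1.val
  invFun s := ⟨⟨x, s⟩, rfl⟩
  left_inv := by rintro ⟨⟨y, s⟩, rfl⟩; rfl
  right_inv _ := rfl

instance (M : PreCoShf R) (x : M.X) : AddCommGroup (Fibre (PreCoShf.Total.pt (M := M)) x) :=
  (M.fibreEquiv x).addCommGroup

instance (M : PreCoShf R) (x : M.X) : Module R (Fibre (PreCoShf.Total.pt (M := M)) x) :=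
  (M.fibreEquiv x).module R

theorem PreCoShf.fibreEquiv_add (M : PreCoShf R) (x : M.X)
    (a b : Fibre (PreCoShf.Total.pt (M := M)) x) :
    M.fibreEquiv x (a + b) = M.fibreEquiv x a + M.fibreEquiv x b :=
  (M.fibreEquiv x).apply_symm_apply _

theorem PreCoShf.fibreEquiv_smul (M : PreCoShf R) (x : M.X) (r : R)
    (a : Fibre (PreCoShf.Total.pt (M := M)) x) :
    M.fibreEquiv x (r • a) = r • M.fibreEquiv x a :=
  (M.fibreEquiv x).apply_symm_apply _

theorem PreCoShf.ev_fibre (M : PreCoShf R) {U : Clopens M.X} {x : M.X} (h : x ∈ U)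
    (a : Fibre (PreCoShf.Total.pt (M := M)) x) :
    M.ev U a.1 = (M.fibreEquiv x a).1 ⟨U, h⟩ := by
  obtain ⟨⟨y, s⟩, rfl⟩ := a
  exact M.ev_of_mem (m := ⟨y, s⟩) h

theorem PreCoShf.ev_add (M : PreCoShf R) (U : Clopens M.X) (x : M.X)
    (a b : Fibre (PreCoShf.Total.pt (M := M)) x) : M.ev U (a + b).1 = M.ev U a.1 + M.ev U b.1 := by
  by_cases h : x ∈ U
  · rw [M.ev_fibre h, M.ev_fibre h, M.ev_fibre h, M.fibreEquiv_add]; rfl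
  · have h' : ∀ c : Fibre (PreCoShf.Total.pt (M := M)) x, c.1.pt ∉ U := fun c => c.2.symm ▸ h
    rw [M.ev_of_notMem (h' _), M.ev_of_notMem (h' _), M.ev_of_notMem (h' _), add_zero]

theorem PreCoShf.ev_smul (M : PreCoShf R) (U : Clopens M.X) (x : M.X) (r : R)
    (a : Fibre (PreCoShf.Total.pt (M := M)) x) : M.ev U (r • a).1 = r • M.ev U a.1 := by
  by_cases h : x ∈ U
  · rw [M.ev_fibre h, M.ev_fibre h, M.fibreEquiv_smul]; rfl
  · have h' : ∀ c : Fibre (PreCoShf.Total.pt (M := M)) x, c.1.pt ∉ U := fun c => c.2.symm ▸ h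
    rw [M.ev_of_notMem (h' _), M.ev_of_notMem (h' _), smul_zero]

theorem PreCoShf.continuous_ev (M : PreCoShf R) (U : Clopens M.X) : Continuous (M.ev U) :=
  (continuous_apply U).comp (continuous_fst.comp M.isInducing_emb.continuous)

/-- The `sheaf' `⨆_x M_x → X` of the stalks of a precosheaf. -/
noncomputable def PreCoShf.toPShf (M : PreCoShf R) : PShf R where
  X := M.X
  total := Profinite.of M.Total
  p := ⟨PreCoShf.Total.pt, M.continuous_pt⟩
  surjective x := ⟨⟨x, 0⟩, rfl⟩
  addCommGroup x := inferInstanceAs (AddCommGroup (Fibre (PreCoShf.Total.pt (M := M)) x))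
  module x := inferInstanceAs (Module R (Fibre (PreCoShf.Total.pt (M := M)) x))
  continuous_smul := by
    refine M.isInducing_emb.continuous_iff.mpr (Continuous.prodMk (continuous_pi fun U => ?_) ?_)
    · refine (continuous_fst.smul ((M.continuous_ev U).comp continuous_snd)).congr fun z => ?_
      exact (M.ev_smul U z.2.pt z.1 ⟨z.2, rfl⟩).symm
    · refine (M.continuous_pt.comp continuous_snd).congr fun z => ?_
      exact (z.1 • (⟨z.2, rfl⟩ : Fibre (PreCoShf.Total.pt (M := M)) z.2.pt)).2.symm
  continuous_add := by
    refine M.isInducing_emb.continuous_iff.mpr (Continuous.prodMk (continuous_pi fun U => ?_) ?_)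
    · refine (((M.continuous_ev U).comp (continuous_fst.comp continuous_subtype_val)).add
        ((M.continuous_ev U).comp (continuous_snd.comp continuous_subtype_val))).congr fun z => ?_
      exact (M.ev_add U z.1.2.pt ⟨z.1.1, z.2⟩ ⟨z.1.2, rfl⟩).symm
    · refine (M.continuous_pt.comp (continuous_snd.comp continuous_subtype_val)).congr fun z => ?_
      exact ((⟨z.1.1, z.2⟩ : Fibre (PreCoShf.Total.pt (M := M)) z.1.2.pt) + ⟨z.1.2, rfl⟩).2.symm

theorem mem_preim_inf_top {Y X : Type u} [TopologicalSpace Y] [TopologicalSpace X] {f : C(Y, X)}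
    {U : Clopens X} {y : Y} (h : f y ∈ U) : y ∈ preim f U ⊓ ⊤ :=
  ⟨h, trivial⟩

/-- The map `N_y → M_{f(y)}` on stalks induced by a morphism `(Ψ, f) : (N, Y) → (M, X)`, with
components `N_y → N(f⁻¹(U)) = N(f⁻¹(U) ∩ Y) → M(U)`, the last map being `Ψ_{U,Y}`. -/
def PreCoShf.Hom.stalkMap {N M : PreCoShf R} (Ψ : PreCoShf.Hom N M) (y : N.X) :
    N.stalk y →ₗ[R] M.stalk (Ψ.base y) where
  toFun s := ⟨fun U => Ψ.app U.1 ⊤ (s.1 ⟨preim Ψ.base U.1 ⊓ ⊤, mem_preim_inf_top U.2⟩), fun U V h =>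
    (Ψ.naturality h le_rfl _).symm.trans (congrArg (Ψ.app V.1 ⊤)
      (s.2 ⟨_, mem_preim_inf_top U.2⟩ ⟨_, mem_preim_inf_top V.2⟩
        (inf_le_inf (preim_mono _ h) le_rfl)))⟩
  map_add' _ _ := Subtype.ext (funext fun U => map_add (Ψ.app U.1 ⊤) _ _)
  map_smul' _ _ := Subtype.ext (funext fun U => map_smul (Ψ.app U.1 ⊤) _ _)

/-- The map `ψ` of total spaces induced by a morphism of precosheaves. -/
def PreCoShf.Hom.totalMap {N M : PreCoShf R} (Ψ : PreCoShf.Hom N M) (n : N.Total) : M.Total :=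
  ⟨Ψ.base n.pt, Ψ.stalkMap n.pt n.val⟩

theorem PreCoShf.Hom.continuous_totalMap {N M : PreCoShf R} (Ψ : PreCoShf.Hom N M) :
    Continuous Ψ.totalMap := by
  refine continuous_generateFrom_iff.mpr ?_
  rintro _ ⟨U, W, hW, rfl⟩
  convert N.isOpen_basicOpen (preim Ψ.base U ⊓ ⊤) (hW.preimage (Ψ.app U ⊤).continuous) using 1
  ext n
  exact ⟨fun h => ⟨⟨h.1, trivial⟩, h.2⟩, fun h => ⟨h.1.1, h.2⟩⟩

theorem PreCoShf.Hom.fibreEquiv_map {N M : PreCoShf R} (Ψ : PreCoShf.Hom N M) (y : N.X)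
    (a : Fibre (PreCoShf.Total.pt (M := N)) y) :
    M.fibreEquiv (Ψ.base y) (Fibre.map (ψ := Ψ.totalMap) (f := Ψ.base) (fun _ => rfl) y a) =
      Ψ.stalkMap y (N.fibreEquiv y a) := by
  obtain ⟨⟨y, s⟩, rfl⟩ := a
  rfl

/-- The morphism of `sheaves' of stalks induced by a morphism of precosheaves. -/
noncomputable def PreCoShf.Hom.toPShf {N M : PreCoShf R} (Ψ : PreCoShf.Hom N M) :
    PShf.Hom N.toPShf M.toPShf where
  base := Ψ.base
  map := ⟨Ψ.totalMap, Ψ.continuous_totalMap⟩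
  comm _ := rfl
  map_add y a b := by
    refine (M.fibreEquiv (Ψ.base y)).injective ?_
    refine (Ψ.fibreEquiv_map y (a + b)).trans ?_
    refine ((congrArg (Ψ.stalkMap y) (N.fibreEquiv_add y a b)).trans
      (map_add (Ψ.stalkMap y) _ _)).trans ?_
    refine Eq.trans ?_ (M.fibreEquiv_add _ _ _).symm
    exact congrArg₂ (· + ·) (Ψ.fibreEquiv_map y a).symm (Ψ.fibreEquiv_map y b).symm
  map_smul y r a := by
    refine (M.fibreEquiv (Ψ.base y)).injective ?_
    refine (Ψ.fibreEquiv_map y (r • a)).trans ?_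
    refine ((congrArg (Ψ.stalkMap y) (N.fibreEquiv_smul y r a)).trans
      (map_smul (Ψ.stalkMap y) _ _)).trans ?_
    refine Eq.trans ?_ (M.fibreEquiv_smul _ _ _).symm
    exact congrArg (r • ·) (Ψ.fibreEquiv_map y a).symm

variable (R) in
/-- The co-étale construction, on all precosheaves. -/
noncomputable def preCoEtale : PreCoShf R ⥤ PShf R where
  obj M := M.toPShf
  map Ψ := PreCoShf.Hom.toPShf Ψ
  map_id M := by
    refine PShf.Hom.ext' rfl (ContinuousMap.ext fun m => ?_)
    obtain ⟨x, s⟩ := m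
    refine congrArg (PreCoShf.Total.mk (M := M) x) (Subtype.ext (funext fun U => ?_))
    exact s.2 ⟨_, _⟩ U _
  map_comp {P N M} Φ Ψ := by
    refine PShf.Hom.ext' rfl (ContinuousMap.ext fun m => ?_)
    obtain ⟨z, s⟩ := m
    refine congrArg (PreCoShf.Total.mk (M := M) _) (Subtype.ext (funext fun U => ?_))
    refine congrArg (PreCoShf.Hom.app Ψ U.1 ⊤) ?_
    have h0 : preim Ψ.base U.1 ≤ preim Ψ.base U.1 ⊓ ⊤ := le_inf le_rfl le_top
    refine (Φ.naturality h0 (le_refl ⊤) _).symm.trans (congrArg (Φ.app _ ⊤) ?_)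
    exact (P.cor_cor _ _ _).trans (s.2 ⟨_, _⟩ ⟨_, _⟩ _)

variable (R) in
/-- The functor `CoÉtale` from cosheaves to `sheaves' of profinite modules: the disjoint union of the
stalks `M_x = lim_{U ∋ x} M(U)`, with the topology generated by the sets `O_{U,W}`. -/
noncomputable def coEtale : CoShf R ⥤ PShf R :=
  (isCosheaf R).ι ⋙ preCoEtale R

end

end ProfSheaf

/-!
The unit of the equivalence sends a point `m` of a `sheaf'` to its germ, the family of all `ω m`.
It is injective: a finite quotient of the fibre extends to an additive map on the fibres over a
clopen neighbourhood, which becomes `R`-linear with values in a coinduced module, and hence factors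
through `ω`. It is surjective by compactness, since the image of `ω` topologically generates
`⊞_{u ∈ U} M_u`.

The counit is induced by evaluation `(m, x) ↦ cor_x^U(m)`. By a triangle identity its map of total
spaces is inverse to the germ map, so it remains to see that a morphism of cosheaves which is
bijective on total spaces is invertible. A closed subgroup containing all images of stalks of a
cosheaf, or of the kernel of a morphism of cosheaves, contains every section: otherwise some open
subgroup misses a section, and by finite additivity over disjoint clopens this failure persists in
all neighbourhoods of one point, where compactness produces an element of the stalk.
-/

namespace ProfSheaf

variable {R : Type u} [Ring R] [TopologicalSpace R]

/-! ### Closed subgroups of profinite groups and of profinite direct sums -/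

theorem exists_isOpen_addSubgroup_of_notMem {P : Type*} [AddGroup P] [TopologicalSpace P]
    [IsTopologicalAddGroup P] [CompactSpace P] [TotallyDisconnectedSpace P] {B : AddSubgroup P}
    (hB : IsClosed (B : Set P)) {s : P} (hs : s ∉ B) :
    ∃ K : AddSubgroup P, IsOpen (K : Set P) ∧ B ≤ K ∧ s ∉ K := by
  have hinf : B = sInf {K : AddSubgroup P | IsOpen (K : Set P) ∧ B ≤ K} :=
    ProfiniteGrp.closedAddSubgroup_eq_sInf_open ⟨B, hB⟩
  rw [hinf, AddSubgroup.mem_sInf] at hs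
  push Not at hs
  obtain ⟨K, ⟨hK, hBK⟩, hsK⟩ := hs
  exact ⟨K, hK, hBK, hsK⟩

/-- The total space of a `sheaf' is stable under scalars, so the largest submodule inside `K`
contains it and the universal property applies to that submodule. -/
theorem PShf.eq_top_of_omega_mem (M : PShf R) {U : Clopens M.X}
    {K : AddSubgroup (M.directSum U)} (hK : IsClosed (K : Set (M.directSum U)))
    (hω : ∀ m, (M.omega U).toMap m ∈ K) : K = ⊤ := by
  let W : Submodule R (M.directSum U) :=
    { carrier := {d | ∀ r : R, r • d ∈ K}
      add_mem' := fun ha hb r => by rw [smul_add]; exact add_mem (ha r) (hb r)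
      zero_mem' := fun r => by rw [smul_zero]; exact zero_mem K
      smul_mem' := fun c d hd r => by rw [smul_smul]; exact hd (r * c) }
  have hW : IsClosed (W : Set (M.directSum U)) := by
    have hInter : (W : Set (M.directSum U)) = ⋂ r : R, {d | r • d ∈ K} := by ext d; simp [W]
    rw [hInter]
    exact isClosed_iInter fun r => hK.preimage (continuous_const_smul r)
  have hωW (m : M.Over U) : (M.omega U).toMap m ∈ W := fun r => by
    have h := (M.omega U).map_smul _ m.2 r ⟨m.1, rfl⟩
    exact h ▸ hω _
  let β : M.HomOver U (PMod.ofClosed W hW) :=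
    { toMap := ⟨fun m => ⟨_, hωW m⟩, (M.omega U).toMap.continuous.subtype_mk _⟩
      map_add := fun x hx a b => Subtype.ext ((M.omega U).map_add x hx a b)
      map_smul := fun x hx r a => Subtype.ext ((M.omega U).map_smul x hx r a) }
  have hretract : W.subtypeL.comp (M.lift β) = ContinuousLinearMap.id R (M.directSum U) :=
    M.directSum_ext fun m => congrArg Subtype.val (M.lift_omega β m)
  refine (AddSubgroup.eq_top_iff' K).mpr fun d => ?_
  have hd : d ∈ W := by
    rw [← ContinuousLinearMap.id_apply (R₁ := R) d, ← hretract]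
    exact (M.lift β d).2
  simpa only [one_smul] using hd 1

/-! ### The precosheaf of profinite direct sums is a cosheaf -/

/-- The corestriction `⊞_{u ∈ U} M_u → ⊞_{u ∈ V} M_u` of the precosheaf `M.toPreCoShf`, stated
for the profinite direct sums themselves. -/
noncomputable def PShf.cor (M : PShf R) {U V : Clopens M.X} (h : U ≤ V) :
    M.directSum U →L[R] M.directSum V :=
  M.toPreCoShf.cor h

theorem PShf.cor_cor (M : PShf R) {U V W : Clopens M.X} (h : U ≤ V) (k : V ≤ W)
    (a : M.directSum U) : M.cor k (M.cor h a) = M.cor (h.trans k) a :=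
  M.toPreCoShf.cor_cor h k a

theorem PShf.cor_omega (M : PShf R) {U V : Clopens M.X} (h : U ≤ V) (m : M.Over U) :
    M.cor h ((M.omega U).toMap m) = (M.omega V).toMap ⟨m.1, h m.2⟩ :=
  PShf.sumHom_omega (𝟙 M) (V := U) (U := V) h m

theorem PShf.HomOver.continuous_extend {M : PShf R} {D : Clopens M.X} {P : PMod R}
    (β : M.HomOver D P) : Continuous (Function.extend Subtype.val β.toMap 0) := by
  have hD : IsClopen {m : M.total | M.p m ∈ D} := D.isClopen.preimage M.p.continuous
  have : CompactSpace (M.Over D) := isCompact_iff_compactSpace.mp hD.isClosed.isCompact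
  exact (HasCompactSupport.of_compactSpace β.toMap).continuous_extend_zero hD.isOpen
    β.toMap.continuous

/-- The `sheaf' morphism on `E` that agrees with `β` over `E ∩ D` and vanishes outside `D`. -/
noncomputable def PShf.HomOver.extendByZero {M : PShf R} {D : Clopens M.X} {P : PMod R}
    (β : M.HomOver D P) (E : Clopens M.X) : M.HomOver E P where
  toMap := ⟨fun m => Function.extend Subtype.val β.toMap 0 m.1,
    β.continuous_extend.comp continuous_subtype_val⟩
  map_add x hx a b := by
    by_cases hD : x ∈ D
    · have h (c : Fibre M.p x) : Function.extend Subtype.val β.toMap 0 c.1 =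
          β.toMap (M.toOver hD c) := Subtype.val_injective.extend_apply β.toMap 0 (M.toOver hD c)
      simpa only [← h] using! β.map_add x hD a b
    · have h (c : Fibre M.p x) : Function.extend Subtype.val β.toMap 0 c.1 = 0 :=
        Function.extend_apply' _ _ _ fun ⟨m, hm⟩ => hD (c.2 ▸ hm ▸ m.2)
      exact (h _).trans (((congrArg₂ (· + ·) (h a) (h b))).trans (add_zero 0)).symm
  map_smul x hx r a := by
    by_cases hD : x ∈ D
    · have h (c : Fibre M.p x) : Function.extend Subtype.val β.toMap 0 c.1 =
          β.toMap (M.toOver hD c) := Subtype.val_injective.extend_apply β.toMap 0 (M.toOver hD c)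
      simpa only [← h] using! β.map_smul x hD r a
    · have h (c : Fibre M.p x) : Function.extend Subtype.val β.toMap 0 c.1 = 0 :=
        Function.extend_apply' _ _ _ fun ⟨m, hm⟩ => hD (c.2 ▸ hm ▸ m.2)
      exact (h _).trans ((congrArg (r • ·) (h a)).trans (smul_zero r)).symm

theorem PShf.HomOver.extendByZero_of_mem {M : PShf R} {D : Clopens M.X} {P : PMod R}
    (β : M.HomOver D P) {E : Clopens M.X} (m : M.Over E) (hm : M.p m.1 ∈ D) :
    (β.extendByZero E).toMap m = β.toMap ⟨m.1, hm⟩ :=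
  Subtype.val_injective.extend_apply β.toMap 0 ⟨m.1, hm⟩

theorem PShf.HomOver.extendByZero_of_notMem {M : PShf R} {D : Clopens M.X} {P : PMod R}
    (β : M.HomOver D P) {E : Clopens M.X} (m : M.Over E) (hm : M.p m.1 ∉ D) :
    (β.extendByZero E).toMap m = 0 :=
  Function.extend_apply' _ _ _ fun ⟨m', h⟩ => hm (h ▸ m'.2)

/-- The projection `⊞_{u ∈ E} M_u → ⊞_{u ∈ D} M_u`, which kills the summands outside `D`. No
inclusion between `D` and `E` is assumed. -/
noncomputable def PShf.proj (M : PShf R) (E D : Clopens M.X) : M.directSum E →L[R] M.directSum D :=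
  M.lift ((M.omega D).extendByZero E)

theorem PShf.proj_omega_of_mem (M : PShf R) {E D : Clopens M.X} (m : M.Over E)
    (hm : M.p m.1 ∈ D) : M.proj E D ((M.omega E).toMap m) = (M.omega D).toMap ⟨m.1, hm⟩ :=
  (M.lift_omega _ m).trans ((M.omega D).extendByZero_of_mem m hm)

theorem PShf.proj_omega_of_notMem (M : PShf R) {E D : Clopens M.X} (m : M.Over E)
    (hm : M.p m.1 ∉ D) : M.proj E D ((M.omega E).toMap m) = 0 :=
  (M.lift_omega _ m).trans ((M.omega D).extendByZero_of_notMem m hm)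

theorem PShf.proj_cor (M : PShf R) {E E' D : Clopens M.X} (h : E' ≤ E) (a : M.directSum E') :
    M.proj E D (M.cor h a) = M.proj E' D a := by
  have key : (M.proj E D).comp (M.cor h) = M.proj E' D := by
    refine M.directSum_ext fun m => ?_
    rw [ContinuousLinearMap.comp_apply, M.cor_omega]
    by_cases hm : M.p m.1 ∈ D
    · exact (M.proj_omega_of_mem ⟨m.1, h m.2⟩ hm).trans (M.proj_omega_of_mem m hm).symm
    · exact (M.proj_omega_of_notMem ⟨m.1, h m.2⟩ hm).trans (M.proj_omega_of_notMem m hm).symm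
  exact DFunLike.congr_fun key a

theorem PShf.cor_proj_inf (M : PShf R) {E D : Clopens M.X} (a : M.directSum E) :
    M.cor (inf_le_left : D ⊓ E ≤ D) (M.proj E (D ⊓ E) a) = M.proj E D a := by
  have key : (M.cor inf_le_left).comp (M.proj E (D ⊓ E)) = M.proj E D := by
    refine M.directSum_ext fun m => ?_
    rw [ContinuousLinearMap.comp_apply]
    by_cases hm : M.p m.1 ∈ D
    · rw [M.proj_omega_of_mem m (D := D ⊓ E) ⟨hm, m.2⟩, M.proj_omega_of_mem m hm, M.cor_omega]
    · rw [M.proj_omega_of_notMem m (D := D ⊓ E) fun h => hm h.1, M.proj_omega_of_notMem m hm,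
        map_zero]
  exact DFunLike.congr_fun key a

theorem mem_clopens_finset_sup {X ι : Type*} [TopologicalSpace X] {U : ι → Clopens X}
    {s : Finset ι} {x : X} : x ∈ s.sup U ↔ ∃ i ∈ s, x ∈ U i := by
  induction s using Finset.cons_induction with
  | empty => exact ⟨False.elim, fun ⟨i, hi, _⟩ => (Finset.notMem_empty i hi).elim⟩
  | cons i s hi ih =>
    simp only [Finset.sup_cons, Finset.mem_cons, exists_eq_or_imp, ← ih]
    exact Iff.rfl

theorem PShf.sum_cor_proj (M : PShf R) {ι : Type*} [Fintype ι] {E : Clopens M.X}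
    {D : ι → Clopens M.X} (hDE : ∀ i, D i ≤ E) (hE : E ≤ Finset.univ.sup D)
    (hdisj : Pairwise (Function.onFun Disjoint D)) (a : M.directSum E) :
    ∑ i, M.cor (hDE i) (M.proj E (D i) a) = a := by
  have key : ∑ i, (M.cor (hDE i)).comp (M.proj E (D i)) =
      ContinuousLinearMap.id R (M.directSum E) := by
    refine M.directSum_ext fun m => ?_
    obtain ⟨i, -, hi⟩ := mem_clopens_finset_sup.mp (hE m.2)
    rw [sum_apply, Finset.sum_eq_single_of_mem i (Finset.mem_univ i),
      ContinuousLinearMap.comp_apply, M.proj_omega_of_mem m hi, M.cor_omega]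
    · rfl
    · intro j _ hj
      have hmj : M.p m.1 ∉ D j := fun h => (hdisj hj).le_bot ⟨h, hi⟩
      rw [ContinuousLinearMap.comp_apply, M.proj_omega_of_notMem m hmj, map_zero]
  simpa only [sum_apply] using! DFunLike.congr_fun key a

theorem PreCoShf.sumMap_apply (M : PreCoShf R) {n : ℕ} (U : Fin n → Clopens M.X)
    (a : ∀ i, M.F.obj (U i)) : M.sumMap U a =
      ∑ i, M.cor (Finset.le_sup (f := U) (Finset.mem_univ i)) (a i) := by
  simp [PreCoShf.sumMap]

theorem PreCoShf.pMap_apply (M : PreCoShf R) {n : ℕ} (U : Fin n → Clopens M.X)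
    (b : ∀ ij : Fin n × Fin n, M.F.obj (U ij.1 ⊓ U ij.2)) (i : Fin n) :
    M.pMap U b i = ∑ j, M.cor inf_le_left (b (i, j)) := by
  simp only [PreCoShf.pMap, LinearMap.sum_apply, Finset.sum_apply, LinearMap.comp_apply,
    Fintype.sum_prod_type]
  rw [Finset.sum_eq_single_of_mem i (Finset.mem_univ i)]
  · exact Finset.sum_congr rfl fun j _ => Pi.single_eq_same _ _
  · exact fun k _ hk => Finset.sum_eq_zero fun j _ => Pi.single_eq_of_ne hk.symm _

theorem PreCoShf.qMap_apply (M : PreCoShf R) {n : ℕ} (U : Fin n → Clopens M.X)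
    (b : ∀ ij : Fin n × Fin n, M.F.obj (U ij.1 ⊓ U ij.2)) (j : Fin n) :
    M.qMap U b j = ∑ i, M.cor inf_le_right (b (i, j)) := by
  simp only [PreCoShf.qMap, LinearMap.sum_apply, Finset.sum_apply, LinearMap.comp_apply,
    Fintype.sum_prod_type_right]
  rw [Finset.sum_eq_single_of_mem j (Finset.mem_univ j)]
  · exact Finset.sum_congr rfl fun i _ => Pi.single_eq_same _ _
  · exact fun k _ hk => Finset.sum_eq_zero fun i _ => Pi.single_eq_of_ne hk.symm _

theorem PreCoShf.sumMap_pMap_sub_qMap (M : PreCoShf R) {n : ℕ} (U : Fin n → Clopens M.X)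
    (b : ∀ ij : Fin n × Fin n, M.F.obj (U ij.1 ⊓ U ij.2)) :
    M.sumMap U ((M.pMap U - M.qMap U) b) = 0 := by
  rw [LinearMap.sub_apply, map_sub, sub_eq_zero, M.sumMap_apply, M.sumMap_apply]
  simp only [M.pMap_apply, M.qMap_apply, map_sum, M.cor_cor]
  exact Finset.sum_comm

/-- For a disjoint refinement `D` of `U`, the contracting homotopy of the cosheaf sequence of
`M.toPreCoShf` and `U`; on the summand over `U j` it projects to the pieces `D i ∩ U j`. -/
noncomputable def PShf.refinementHomotopy (M : PShf R) {ι : Type*} {U D : ι → Clopens M.X}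
    (hDU : D ≤ U) (a : ∀ i, M.directSum (U i)) (ij : ι × ι) : M.directSum (U ij.1 ⊓ U ij.2) :=
  M.cor (inf_le_inf_right (U ij.2) (hDU ij.1)) (M.proj (U ij.2) (D ij.1 ⊓ U ij.2) (a ij.2))

section

variable (M : PShf R) {ι : Type*} [Fintype ι] {U D : ι → Clopens M.X} (hDU : D ≤ U)
  (a : ∀ i, M.directSum (U i))

theorem PShf.sum_cor_refinementHomotopy_right (hsup : Finset.univ.sup D = Finset.univ.sup U)
    (hdisj : Pairwise (Function.onFun Disjoint D)) (j : ι) :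
    ∑ i, M.cor inf_le_right (M.refinementHomotopy hDU a (i, j)) = a j := by
  have hcover : U j ≤ Finset.univ.sup fun i => D i ⊓ U j := by
    rw [← Finset.sup_inf_distrib_right, hsup]
    exact le_inf (Finset.le_sup (Finset.mem_univ j)) le_rfl
  simp only [refinementHomotopy, M.cor_cor]
  exact M.sum_cor_proj (fun i => inf_le_right) hcover
    (fun i k hik => (hdisj hik).mono inf_le_left inf_le_left) (a j)

theorem PShf.sum_cor_refinementHomotopy_left (i : ι) :
    ∑ j, M.cor inf_le_left (M.refinementHomotopy hDU a (i, j)) =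
      M.cor (hDU i) (M.proj (Finset.univ.sup U) (D i)
        (∑ j, M.cor (Finset.le_sup (Finset.mem_univ j)) (a j))) := by
  rw [map_sum, map_sum]
  refine Finset.sum_congr rfl fun j _ => ?_
  rw [refinementHomotopy, M.proj_cor, M.cor_cor, ← M.cor_proj_inf (D := D i), M.cor_cor]

end

theorem PShf.isCosheaf_toPreCoShf (M : PShf R) : isCosheaf R M.toPreCoShf := by
  intro n (U : Fin n → Clopens M.X)
  obtain ⟨D, hDU, hsup, hdisj⟩ := Fintype.exists_disjointed_le U
  refine ⟨fun a => ⟨fun ha => ⟨-M.refinementHomotopy hDU a, ?_⟩, ?_⟩,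
    fun a => ⟨fun i => M.cor (hDU i) (M.proj _ (D i) a), ?_⟩⟩
  · have hq : M.toPreCoShf.qMap U (M.refinementHomotopy hDU a) = a := funext fun j =>
      (M.toPreCoShf.qMap_apply U _ j).trans
        (M.sum_cor_refinementHomotopy_right hDU a hsup hdisj j)
    have hp : M.toPreCoShf.pMap U (M.refinementHomotopy hDU a) = 0 := by
      funext i
      have hsum : ∑ j, M.cor (Finset.le_sup (Finset.mem_univ j)) (a j) = 0 :=
        (M.toPreCoShf.sumMap_apply U a).symm.trans ha
      refine (M.toPreCoShf.pMap_apply U _ i).trans ?_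
      refine (M.sum_cor_refinementHomotopy_left hDU a i).trans ?_
      rw [hsum, map_zero, map_zero]
      rfl
    refine (map_neg (M.toPreCoShf.pMap U - M.toPreCoShf.qMap U) _).trans ?_
    exact (neg_sub (M.toPreCoShf.pMap U _) _).trans ((congrArg₂ (· - ·) hq hp).trans (sub_zero a))
  · rintro ⟨b, rfl⟩
    exact M.toPreCoShf.sumMap_pMap_sub_qMap U b
  · refine (M.toPreCoShf.sumMap_apply U _).trans ?_
    refine (Finset.sum_congr rfl fun i _ => M.cor_cor _ _ _).trans ?_
    exact M.sum_cor_proj _ hsup.ge hdisj a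

/-! ### Cosheaves on disjoint clopen sets -/

theorem PreCoShf.subsingleton_bot {M : PreCoShf R} (hM : isCosheaf R M) :
    Subsingleton (M.F.obj ⊥) := by
  refine ⟨fun a b => ?_⟩
  obtain ⟨a', rfl⟩ := (hM 0 Fin.elim0).2 a
  obtain ⟨b', rfl⟩ := (hM 0 Fin.elim0).2 b
  rw [Subsingleton.elim a' b']

theorem PreCoShf.cor_eq_zero_of_le_bot {M : PreCoShf R} (hM : isCosheaf R M) {U V : Clopens M.X}
    (h : U ≤ V) (hU : U ≤ ⊥) (a : M.F.obj U) : M.cor h a = 0 := by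
  have := subsingleton_bot hM
  rw [← M.cor_cor hU bot_le, Subsingleton.elim (M.cor hU a) 0, map_zero]

theorem PreCoShf.sumMap_injective {M : PreCoShf R} (hM : isCosheaf R M) {n : ℕ}
    {U : Fin n → Clopens M.X} (hU : Pairwise (Function.onFun Disjoint U)) :
    Function.Injective (M.sumMap U) := by
  refine (injective_iff_map_eq_zero (M.sumMap U)).mpr fun a ha => ?_
  obtain ⟨b, rfl⟩ := ((hM n U).1 a).mp ha
  rw [LinearMap.sub_apply, sub_eq_zero]
  funext i
  rw [M.pMap_apply, M.qMap_apply]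
  refine Finset.sum_congr rfl fun j _ => ?_
  rcases eq_or_ne i j with rfl | hij
  · rfl
  · rw [cor_eq_zero_of_le_bot hM _ (hU hij).le_bot, cor_eq_zero_of_le_bot hM _ (hU hij.symm).le_bot]

theorem univ_sup_pair {α : Type*} [SemilatticeSup α] [OrderBot α] (a b : α) :
    Finset.univ.sup ![a, b] = a ⊔ b := by
  rw [Finset.univ_fin2]
  simp

theorem PreCoShf.exists_cor_add_cor {M : PreCoShf R} (hM : isCosheaf R M) {U V : Clopens M.X}
    (a : M.F.obj (U ⊔ V)) : ∃ (b : M.F.obj U) (c : M.F.obj V),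
      a = M.cor le_sup_left b + M.cor le_sup_right c := by
  have hUV := univ_sup_pair U V
  obtain ⟨s, hs⟩ := (hM 2 ![U, V]).2 (M.cor hUV.ge a)
  refine ⟨s 0, s 1, ?_⟩
  have h := congrArg (M.cor hUV.le) hs
  rw [M.cor_cor, M.cor_self, M.sumMap_apply, map_sum, Fin.sum_univ_two, M.cor_cor, M.cor_cor] at h
  exact h.symm

theorem PreCoShf.eq_zero_of_cor_add_cor {M : PreCoShf R} (hM : isCosheaf R M)
    {U V : Clopens M.X} (hUV : Disjoint U V) {b : M.F.obj U} {c : M.F.obj V}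
    (h : M.cor le_sup_left b + M.cor le_sup_right c = (0 : M.F.obj (U ⊔ V))) :
    b = 0 ∧ c = 0 := by
  let s : ∀ i, M.F.obj (![U, V] i) := Fin.cons b (Fin.cons c finZeroElim)
  have hdisj : Pairwise (Function.onFun Disjoint ![U, V]) := by
    rw [pairwise_disjoint_on]
    intro i j hij
    fin_cases i <;> fin_cases j <;> first | exact hUV | exact absurd hij (by decide)
  have hs : M.sumMap ![U, V] s = 0 := by
    have h' := congrArg (M.cor (univ_sup_pair U V).ge) h
    rw [map_add, map_zero, M.cor_cor, M.cor_cor] at h'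
    rw [M.sumMap_apply, Fin.sum_univ_two]
    exact h'
  have hs0 := sumMap_injective hM hdisj (hs.trans (map_zero _).symm)
  exact ⟨congrFun hs0 0, congrFun hs0 1⟩

/-! ### Fibres of a `sheaf' -/

section

variable (M : PShf R) {x : M.X}

instance : SMul R M.total := ⟨fun r m => (r • (⟨m, rfl⟩ : Fibre M.p (M.p m))).1⟩

theorem PShf.smul_val (r : R) (a : Fibre M.p x) : (r • a).1 = r • a.1 := by
  obtain ⟨m, rfl⟩ := a
  rfl

theorem PShf.add_val (a b : Fibre M.p x) :
    (a + b).1 = ((⟨a.1, a.2.trans b.2.symm⟩ : Fibre M.p (M.p b.1)) + ⟨b.1, rfl⟩).1 := by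
  obtain ⟨m, rfl⟩ := b
  rfl

instance : MulAction R M.total where
  one_smul m := congrArg Subtype.val (one_smul R (⟨m, rfl⟩ : Fibre M.p (M.p m)))
  mul_smul r s m := (congrArg Subtype.val (mul_smul r s (⟨m, rfl⟩ : Fibre M.p (M.p m)))).trans
    (M.smul_val r _)

instance : ContinuousSMul R M.total := ⟨M.continuous_smul⟩

instance : ContinuousSMul R (Fibre M.p x) where
  continuous_smul := by
    have h : Continuous fun z : R × Fibre M.p x => (z.1 • z.2).1 := by
      simp only [M.smul_val]
      exact continuous_fst.smul (continuous_subtype_val.comp continuous_snd)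
    exact h.subtype_mk fun z => (z.1 • z.2).2

instance : IsTopologicalAddGroup (Fibre M.p x) where
  continuous_add := by
    have hval : Continuous fun z : Fibre M.p x × Fibre M.p x =>
        (⟨(z.1.1, z.2.1), z.1.2.trans z.2.2.symm⟩ :
          {z : M.total × M.total // M.p z.1 = M.p z.2}) :=
      (continuous_subtype_val.prodMap continuous_subtype_val).subtype_mk _
    have h : Continuous fun z : Fibre M.p x × Fibre M.p x => (z.1 + z.2).1 :=
      (M.continuous_add.comp hval).congr fun z => (M.add_val z.1 z.2).symm
    exact h.subtype_mk fun z => (z.1 + z.2).2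
  continuous_neg := by
    simpa only [neg_one_smul] using continuous_const_smul (T := Fibre M.p x) (-1 : R)

instance : CompactSpace (Fibre M.p x) :=
  isCompact_iff_compactSpace.mp (isClosed_singleton.preimage M.p.continuous).isCompact

instance (U : Clopens M.X) : CompactSpace (M.Over U) :=
  isCompact_iff_compactSpace.mp (U.isClosed.preimage M.p.continuous).isCompact

instance : CompactSpace {z : M.total × M.total // M.p z.1 = M.p z.2} :=
  isCompact_iff_compactSpace.mp (isClosed_eq (M.p.continuous.comp continuous_fst)
    (M.p.continuous.comp continuous_snd)).isCompact

end

theorem exists_clopens_disjoint_image {X : Profinite.{u}} {Z : Type*} [TopologicalSpace Z]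
    [CompactSpace Z] {π : Z → X} (hπ : Continuous π) {B : Set Z} (hB : IsClosed B) {x : X}
    (hx : ∀ z ∈ B, π z ≠ x) : ∃ U : Clopens X, x ∈ U ∧ ∀ z ∈ B, π z ∉ U := by
  have hcl : IsClosed (π '' B) := (hB.isCompact.image hπ).isClosed
  obtain ⟨V, hV, hxV, hVB⟩ := compact_exists_isClopen_in_isOpen hcl.isOpen_compl
    (x := x) fun ⟨z, hz, h⟩ => hx z hz h
  exact ⟨⟨V, hV⟩, hxV, fun z hz h => hVB h ⟨z, hz, rfl⟩⟩

theorem PShf.exists_fibrewise_additive_extension (M : PShf R) {x : M.X} {F : Type*}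
    [AddCommGroup F] [TopologicalSpace F] [DiscreteTopology F] [Finite F] (f : Fibre M.p x →+ F)
    (hf : Continuous f) :
    ∃ (k : C(M.total, F)) (U : Clopens M.X), x ∈ U ∧ (∀ a : Fibre M.p x, k a.1 = f a) ∧
      ∀ y ∈ U, ∀ a b : Fibre M.p y, k (a + b).1 = k a.1 + k b.1 := by
  obtain ⟨k, hk, -, hkf⟩ := Profinite.exists_lift_of_finite_of_injective_of_surjective
    (Subtype.val : Fibre M.p x → M.total) continuous_subtype_val Subtype.val_injective
    (fun _ : F => PUnit.unit.{1}) (fun _ => ⟨0, rfl⟩) f hf (fun _ => PUnit.unit)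
    continuous_const rfl
  replace hkf (a : Fibre M.p x) : k a.1 = f a := congrFun hkf a
  let defect (z : {z : M.total × M.total // M.p z.1 = M.p z.2}) : F :=
    k (((⟨z.1.1, z.2⟩ : Fibre M.p (M.p z.1.2)) + ⟨z.1.2, rfl⟩).1) - (k z.1.1 + k z.1.2)
  have hdefect : Continuous defect := (hk.comp M.continuous_add).sub
    ((hk.comp (continuous_fst.comp continuous_subtype_val)).add
      (hk.comp (continuous_snd.comp continuous_subtype_val)))
  obtain ⟨U, hxU, hU⟩ := exists_clopens_disjoint_image
    (π := fun z : {z : M.total × M.total // M.p z.1 = M.p z.2} => M.p z.1.2)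
    (M.p.continuous.comp (continuous_snd.comp continuous_subtype_val))
    ((isClosed_discrete {0}ᶜ).preimage hdefect) (x := x) (by
      rintro ⟨⟨m, m'⟩, h⟩ hz rfl
      refine hz (sub_eq_zero.mpr ?_)
      have hadd := map_add f ⟨m, h⟩ ⟨m', rfl⟩
      rwa [← hkf, ← hkf, ← hkf] at hadd)
  refine ⟨⟨k, hk⟩, U, hxU, hkf, fun y hy a b => ?_⟩
  have hz : defect ⟨(a.1, b.1), a.2.trans b.2.symm⟩ = 0 :=
    by_contra fun h => hU _ h (b.2.symm ▸ hy)
  exact (congrArg k (M.add_val a b)).trans (sub_eq_zero.mp hz)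

/-! ### Coinduced modules -/

/-- The additive maps `R → F` that vanish on the right ideal `J`, as a subgroup of the product
`R → F`. It is a model of `Hom(R ⧸ J, F)`, on which `R` acts by `(s • f) r = f (r * s)`. -/
def coinduced (J : Submodule Rᵐᵒᵖ R) (F : Type*) [AddCommGroup F] : AddSubgroup (R → F) where
  carrier := {f | (∀ r s, f (r + s) = f r + f s) ∧ ∀ r ∈ J, f r = 0}
  add_mem' {f g} hf hg := ⟨fun r s => by
    simp only [Pi.add_apply, hf.1, hg.1]; abel, fun r hr => by simp [hf.2 r hr, hg.2 r hr]⟩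
  zero_mem' := ⟨fun _ _ => (add_zero 0).symm, fun _ _ => rfl⟩
  neg_mem' {f} hf := ⟨fun r s => by
    simp only [Pi.neg_apply, hf.1, neg_add], fun r hr => by simp [hf.2 r hr]⟩

section

variable {J : Submodule Rᵐᵒᵖ R} {F : Type*} [AddCommGroup F]

instance : Module R (coinduced J F) where
  smul s f := ⟨fun r => f.1 (r * s), fun r t => by simp only [add_mul, f.2.1],
    fun _ hr => f.2.2 _ (J.smul_mem (MulOpposite.op s) hr)⟩
  one_smul f := Subtype.ext (funext fun r => congrArg f.1 (mul_one r))
  mul_smul s t f := Subtype.ext (funext fun r => congrArg f.1 (mul_assoc r s t).symm)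
  smul_zero _ := rfl
  smul_add _ _ _ := rfl
  add_smul s t f := Subtype.ext (funext fun r =>
    (congrArg f.1 (mul_add r s t)).trans (f.2.1 (r * s) (r * t)))
  zero_smul f := Subtype.ext (funext fun r =>
    (congrArg f.1 (mul_zero r)).trans (f.2.2 0 J.zero_mem))

variable [TopologicalSpace F]

omit [TopologicalSpace R] in
theorem isClosed_coinduced [ContinuousAdd F] [T2Space F] :
    IsClosed (coinduced J F : Set (R → F)) := by
  have hvanish : IsClosed {f : R → F | ∀ r ∈ J, f r = 0} := by
    simp only [Set.ofPred_forall]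
    exact isClosed_biInter fun r _ => isClosed_eq (continuous_apply r) continuous_const
  exact (isClosed_setOfPred_map_add R F).inter hvanish

theorem continuousSMul_coinduced (hJ : ∀ r s : R, ∀ᶠ t in nhds s, r * t - r * s ∈ J) :
    ContinuousSMul R (coinduced J F) := by
  refine ⟨Continuous.subtype_mk (continuous_pi fun r => continuous_iff_continuousAt.mpr ?_) _⟩
  rintro ⟨s, f⟩
  have heval : Continuous fun z : R × coinduced J F => z.2.1 (r * s) :=
    (continuous_apply _).comp (continuous_subtype_val.comp continuous_snd)
  refine heval.continuousAt.congr ?_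
  filter_upwards [continuousAt_fst.eventually (hJ r s)] with z hz
  have hsplit := z.2.2.1 (r * z.1 - r * s) (r * s)
  rw [sub_add_cancel, z.2.2.2 _ hz, zero_add] at hsplit
  exact hsplit.symm

end

/-- The coinduced module of a profinite abelian group `F`. The hypothesis says that right
multiplication on the discrete group `R ⧸ J` is continuous. -/
def PMod.coinduced (J : Submodule Rᵐᵒᵖ R) (hJ : ∀ r s : R, ∀ᶠ t in nhds s, r * t - r * s ∈ J)
    (F : Type u) [AddCommGroup F] [TopologicalSpace F] [IsTopologicalAddGroup F] [CompactSpace F]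
    [T2Space F] [TotallyDisconnectedSpace F] : PMod R :=
  haveI : CompactSpace (ProfSheaf.coinduced J F) :=
    isCompact_iff_compactSpace.mp isClosed_coinduced.isCompact
  haveI := continuousSMul_coinduced (F := F) hJ
  { carrier := ProfSheaf.coinduced J F }

/-! ### Profinite direct sums separate the points of a fibre -/

section

variable (M : PShf R) {U : Clopens M.X} {F : Type u} [AddCommGroup F] [TopologicalSpace F]
  (k : C(M.total, F)) (hk : ∀ y ∈ U, ∀ a b : Fibre M.p y, k (a + b).1 = k a.1 + k b.1)

/-- The right ideal of all `r` such that the fibrewise additive map `k` vanishes on `r • p⁻¹(U)`. -/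
def PShf.vanishingIdeal : Submodule Rᵐᵒᵖ R where
  carrier := {r | ∀ y ∈ U, ∀ a : Fibre M.p y, k (r • a).1 = 0}
  add_mem' {r s} hr hs y hy a := by rw [add_smul, hk y hy, hr y hy, hs y hy, add_zero]
  zero_mem' y hy a := by simpa using hk y hy 0 0
  smul_mem' s r hr y hy a := by
    rw [MulOpposite.smul_eq_mul_unop, mul_smul]
    exact hr y hy _

theorem PShf.eventually_sub_mem_vanishingIdeal [DiscreteTopology F] (r s : R) :
    ∀ᶠ t in nhds s, r * t - r * s ∈ M.vanishingIdeal k hk := by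
  let defect (z : R × M.Over U) : F := k (r • z.1 • z.2.1) - k (r • s • z.2.1)
  have hdefect : Continuous defect := by fun_prop
  have hopen : IsOpen (defect ⁻¹' {0}) := (isOpen_discrete {0}).preimage hdefect
  filter_upwards [isCompact_univ.eventually_forall_of_forall_eventually
    (P := fun t m => defect (t, m) = 0) fun m _ =>
      hopen.mem_nhds (sub_self (k (r • s • m.1)))] with t ht y hy a
  have hadd := hk y hy ((r * t - r * s) • a) ((r * s) • a)
  rw [← add_smul, sub_add_cancel, M.smul_val (r * t), M.smul_val (r * s), mul_smul, mul_smul,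
    sub_eq_zero.mp (ht ⟨a.1, a.2.symm ▸ hy⟩ trivial)] at hadd
  exact right_eq_add.mp hadd

end

theorem PShf.exists_homOver_of_fibrewise_additive (M : PShf R) {U : Clopens M.X} {F : Type u}
    [AddCommGroup F] [TopologicalSpace F] [DiscreteTopology F] [Finite F] (k : C(M.total, F))
    (hk : ∀ y ∈ U, ∀ a b : Fibre M.p y, k (a + b).1 = k a.1 + k b.1) :
    ∃ (P : PMod R) (β : M.HomOver U P), ∀ m, β.toMap m = 0 → k m.1 = 0 := by
  have hcont : Continuous fun (m : M.Over U) (r : R) => k (r • m.1) := by fun_prop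
  let β : M.HomOver U (PMod.coinduced _ (M.eventually_sub_mem_vanishingIdeal k hk) F) :=
    { toMap :=
        { toFun := fun ⟨m, hm⟩ => ⟨fun r => k (r • m),
            fun r s => by
              have hadd := hk _ hm (r • ⟨m, rfl⟩) (s • ⟨m, rfl⟩)
              rwa [← add_smul] at hadd,
            fun r hr => hr _ hm ⟨m, rfl⟩⟩
          continuous_toFun := hcont.subtype_mk _ }
      map_add x hx a b := Subtype.ext <| funext fun r => by
        have hadd := hk x hx (r • a) (r • b)
        rw [← smul_add, M.smul_val, M.smul_val, M.smul_val] at hadd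
        exact hadd
      map_smul x hx r a := Subtype.ext <| funext fun s => congrArg k <|
        (congrArg (s • ·) (M.smul_val r a)).trans (mul_smul s r a.1).symm }
  refine ⟨_, β, fun m hm => ?_⟩
  have hone : k ((1 : R) • m.1) = 0 := congrFun (congrArg Subtype.val hm) 1
  rwa [one_smul] at hone

theorem PShf.exists_homOver_ne_zero (M : PShf R) {x : M.X} {a : Fibre M.p x} (ha : a ≠ 0) :
    ∃ (U : Clopens M.X) (hx : x ∈ U) (P : PMod R) (β : M.HomOver U P),
      β.toMap (M.toOver hx a) ≠ 0 := by
  obtain ⟨K, hK, -, haK⟩ := exists_isOpen_addSubgroup_of_notMem (P := Fibre M.p x) (B := ⊥)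
    isClosed_singleton (AddSubgroup.mem_bot.not.mpr ha)
  have : DiscreteTopology (Fibre M.p x ⧸ K) := QuotientAddGroup.discreteTopology hK
  have : Finite (Fibre M.p x ⧸ K) := K.quotient_finite_of_isOpen hK
  obtain ⟨k, U, hx, hka, hk⟩ :=
    M.exists_fibrewise_additive_extension (QuotientAddGroup.mk' K) continuous_quotient_mk'
  obtain ⟨P, β, hβ⟩ := M.exists_homOver_of_fibrewise_additive k hk
  refine ⟨U, hx, P, β, fun h0 => haK ?_⟩
  exact (QuotientAddGroup.eq_zero_iff a).mp ((hka a).symm.trans (hβ _ h0))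

/-! ### The stalks of the cosheaf of a `sheaf' -/

/-- The inclusion of a summand, `ω` restricted to a fibre: `M_x → ⊞_{u ∈ U} M_u`. -/
noncomputable def PShf.fibreOmega (M : PShf R) {U : Clopens M.X} {x : M.X} (hx : x ∈ U) :
    Fibre M.p x →L[R] M.directSum U where
  toFun a := (M.omega U).toMap (M.toOver hx a)
  map_add' := (M.omega U).map_add x hx
  map_smul' := (M.omega U).map_smul x hx
  cont := (M.omega U).toMap.continuous.comp (continuous_subtype_val.subtype_mk _)

theorem PShf.eq_zero_of_fibreOmega_eq_zero (M : PShf R) {x : M.X} {a : Fibre M.p x}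
    (h : ∀ (U : Clopens M.X) (hx : x ∈ U), M.fibreOmega hx a = 0) : a = 0 := by
  by_contra ha
  obtain ⟨U, hx, P, β, hβ⟩ := M.exists_homOver_ne_zero ha
  refine hβ ((M.lift_omega β _).symm.trans ?_)
  exact (congrArg (M.lift β) (h U hx)).trans (map_zero _)

theorem PShf.stalk_mem_range_fibreOmega (M : PShf R) {x : M.X} (s : M.toPreCoShf.stalk x)
    {U : Clopens M.X} (hx : x ∈ U) :
    s.1 ⟨U, hx⟩ ∈ (M.fibreOmega hx : Fibre M.p x →+ M.directSum U).range := by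
  by_contra hs
  obtain ⟨K, hK, hrange, hsK⟩ := exists_isOpen_addSubgroup_of_notMem (P := M.directSum U)
    (isCompact_range (M.fibreOmega hx).continuous).isClosed hs
  have hKclosed : IsClosed (K : Set (M.directSum U)) := K.isClosed_of_isOpen hK
  -- The points over `U` that `ω` sends outside `K` form a closed set that misses the fibre at `x`.
  obtain ⟨V, hxV, hV⟩ := exists_clopens_disjoint_image (π := fun m : M.Over U => M.p m.1)
    (M.p.continuous.comp continuous_subtype_val)
    (hK.isClosed_compl.preimage (M.omega U).toMap.continuous) (x := x)
    (fun m hm hmx => hm (hrange ⟨⟨m.1, hmx⟩, rfl⟩))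
  have hcor : K.comap (M.cor (inf_le_right : V ⊓ U ≤ U) : M.directSum (V ⊓ U) →+ _) = ⊤ := by
    refine M.eq_top_of_omega_mem (hKclosed.preimage (M.cor inf_le_right).continuous) fun m => ?_
    by_contra hm
    refine hV ⟨m.1, m.2.2⟩ (fun h => hm ?_) m.2.1
    exact K.mem_comap.mpr ((M.cor_omega _ m).symm ▸ h)
  refine hsK ?_
  rw [← s.2 ⟨V ⊓ U, ⟨hxV, hx⟩⟩ ⟨U, hx⟩ inf_le_right]
  exact hcor.ge (AddSubgroup.mem_top _)

theorem PShf.exists_fibreOmega_eq (M : PShf R) {x : M.X} (s : M.toPreCoShf.stalk x) :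
    ∃ a : Fibre M.p x, ∀ (U : Clopens M.X) (hx : x ∈ U), M.fibreOmega hx a = s.1 ⟨U, hx⟩ := by
  let A : {U : Clopens M.X // x ∈ U} → Set (Fibre M.p x) :=
    fun U => {a | M.fibreOmega U.2 a = s.1 U}
  have hA (U) : IsClosed (A U) := isClosed_eq (M.fibreOmega U.2).continuous continuous_const
  have hmono (U V : {U : Clopens M.X // x ∈ U}) (h : U.1 ≤ V.1) : A U ⊆ A V := fun a ha =>
    (M.cor_omega h (M.toOver U.2 a)).symm.trans ((congrArg (M.cor h) ha).trans (s.2 U V h))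
  have : Nonempty {U : Clopens M.X // x ∈ U} := ⟨⟨⊤, trivial⟩⟩
  obtain ⟨a, ha⟩ := IsCompact.nonempty_iInter_of_directed_nonempty_isCompact_isClosed A
    (fun U V => ⟨⟨U.1 ⊓ V.1, ⟨U.2, V.2⟩⟩, hmono _ _ inf_le_left, hmono _ _ inf_le_right⟩)
    (fun U => M.stalk_mem_range_fibreOmega s U.2) (fun U => (hA U).isCompact) hA
  exact ⟨a, fun U hx => Set.mem_iInter.mp ha ⟨U, hx⟩⟩

/-! ### A `sheaf' is the `sheaf' of stalks of its cosheaf -/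

theorem PShf.Hom.eq_add_of_map_eq {N M : PShf R} (φ : PShf.Hom N M)
    (hφ : Function.Injective φ.map) {x : N.X} {y : M.X} (h : φ.base x = y) {a b : Fibre M.p y}
    {a' b' c' : Fibre N.p x} (ha : φ.map a'.1 = a.1) (hb : φ.map b'.1 = b.1)
    (hc : φ.map c'.1 = (a + b).1) : c' = a' + b' := by
  subst h
  obtain rfl : Fibre.map φ.comm x a' = a := Subtype.ext ha
  obtain rfl : Fibre.map φ.comm x b' = b := Subtype.ext hb
  rw [← φ.map_add] at hc
  exact Subtype.ext (hφ hc)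

theorem PShf.Hom.eq_smul_of_map_eq {N M : PShf R} (φ : PShf.Hom N M)
    (hφ : Function.Injective φ.map) {x : N.X} {y : M.X} (h : φ.base x = y) {r : R}
    {a : Fibre M.p y} {a' c' : Fibre N.p x} (ha : φ.map a'.1 = a.1)
    (hc : φ.map c'.1 = (r • a).1) : c' = r • a' := by
  subst h
  obtain rfl : Fibre.map φ.comm x a' = a := Subtype.ext ha
  rw [← φ.map_smul] at hc
  exact Subtype.ext (hφ hc)

theorem PShf.isIso_of_bijective {N M : PShf R} (φ : N ⟶ M)
    (hb : Function.Bijective (PShf.Hom.base φ)) (ht : Function.Bijective (PShf.Hom.map φ)) :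
    IsIso φ := by
  let Φ : PShf.Hom N M := φ
  let eb : N.X ≃ₜ M.X :=
    Continuous.homeoOfEquivCompactToT2 (f := Equiv.ofBijective _ hb) Φ.base.continuous
  let et : N.total ≃ₜ M.total :=
    Continuous.homeoOfEquivCompactToT2 (f := Equiv.ofBijective _ ht) Φ.map.continuous
  have heb (y) : Φ.base (eb.symm y) = y := eb.apply_symm_apply y
  have het (m) : Φ.map (et.symm m) = m := et.apply_symm_apply m
  let Ψ : PShf.Hom M N :=
    { base := eb.symm
      map := et.symm
      comm := fun m => hb.1 (((Φ.comm _).symm.trans (congrArg M.p (het m))).trans (heb _).symm)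
      map_add := fun y a b =>
        Φ.eq_add_of_map_eq ht.1 (heb y) (het a.1) (het b.1) (het (a + b).1)
      map_smul := fun y r a => Φ.eq_smul_of_map_eq ht.1 (heb y) (het a.1) (het (r • a).1) }
  refine ⟨Ψ, PShf.Hom.ext' ?_ ?_, PShf.Hom.ext' ?_ ?_⟩
  · exact ContinuousMap.ext eb.symm_apply_apply
  · exact ContinuousMap.ext et.symm_apply_apply
  · exact ContinuousMap.ext heb
  · exact ContinuousMap.ext het

theorem PreCoShf.Total.ext_of_val {M : PreCoShf R} {m m' : M.Total} (h : m.pt = m'.pt)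
    (h' : ∀ U (h₁ : m.pt ∈ U) (h₂ : m'.pt ∈ U), m.val.1 ⟨U, h₁⟩ = m'.val.1 ⟨U, h₂⟩) : m = m' := by
  obtain ⟨x, s⟩ := m
  obtain ⟨y, t⟩ := m'
  obtain rfl : x = y := h
  congr 1
  exact Subtype.ext (funext fun U => h' U.1 U.2 U.2)

/-- The germ of a point `m` of a `sheaf'`: the compatible family of its images `ω m` in the
profinite direct sums over the clopen neighbourhoods of `p m`. -/
noncomputable def PShf.germ (M : PShf R) (m : M.total) : M.toPreCoShf.Total where
  pt := M.p m
  val := ⟨fun U => (M.omega U.1).toMap ⟨m, U.2⟩, fun U V h => M.cor_omega (V := V.1) h ⟨m, U.2⟩⟩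

theorem PShf.continuous_germ (M : PShf R) : Continuous M.germ := by
  refine continuous_generateFrom_iff.mpr ?_
  rintro _ ⟨U, W, hW, rfl⟩
  have hU : IsOpen {m : M.total | M.p m ∈ U} := U.isOpen.preimage M.p.continuous
  convert hU.isOpenEmbedding_subtypeVal.isOpenMap _
    (hW.preimage (M.omega U).toMap.continuous) using 1
  ext m
  exact ⟨fun ⟨h, h'⟩ => ⟨⟨m, h⟩, h', rfl⟩, by rintro ⟨⟨m, h⟩, h', rfl⟩; exact ⟨h, h'⟩⟩

theorem PShf.fibreEquiv_germ (M : PShf R) {x : M.X} (a : Fibre M.p x) (U : Clopens M.X)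
    (hx : x ∈ U) : (M.toPreCoShf.fibreEquiv x ⟨M.germ a.1, a.2⟩).1 ⟨U, hx⟩ =
      M.fibreOmega hx a := by
  obtain ⟨m, rfl⟩ := a
  rfl

theorem PShf.germ_injective (M : PShf R) : Function.Injective M.germ := by
  intro m m' h
  have hp : M.p m = M.p m' := congrArg PreCoShf.Total.pt h
  let a : Fibre M.p (M.p m') := ⟨m, hp⟩
  let b : Fibre M.p (M.p m') := ⟨m', rfl⟩
  suffices a - b = 0 from congrArg Subtype.val (sub_eq_zero.mp this)
  refine M.eq_zero_of_fibreOmega_eq_zero fun U hx => ?_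
  rw [map_sub, sub_eq_zero]
  have hev := congrArg (M.toPreCoShf.ev U) h
  rwa [PreCoShf.ev_of_mem (m := M.germ m) _ (show M.p m ∈ U from hp ▸ hx),
    PreCoShf.ev_of_mem (m := M.germ m') _ hx] at hev

theorem PShf.germ_surjective (M : PShf R) : Function.Surjective M.germ := by
  rintro ⟨x, s⟩
  obtain ⟨⟨m, rfl⟩, ha⟩ := M.exists_fibreOmega_eq s
  exact ⟨m, PreCoShf.Total.ext_of_val rfl fun U hU _ => ha U hU⟩

/-- The unit of the equivalence: the germ map, as a morphism from a `sheaf'` to the `sheaf'` of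
stalks of its cosheaf. -/
noncomputable def PShf.toStalks (M : PShf R) : PShf.Hom M M.toPreCoShf.toPShf where
  base := ContinuousMap.id M.X
  map := ⟨M.germ, M.continuous_germ⟩
  comm _ := rfl
  map_add x a b := by
    refine (M.toPreCoShf.fibreEquiv x).injective ?_
    refine Eq.trans ?_ (M.toPreCoShf.fibreEquiv_add x _ _).symm
    refine Subtype.ext (funext fun U => ?_)
    refine (M.fibreEquiv_germ (a + b) U.1 U.2).trans ((map_add (M.fibreOmega U.2) a b).trans ?_)
    exact congrArg₂ (· + ·) (M.fibreEquiv_germ a U.1 U.2).symm (M.fibreEquiv_germ b U.1 U.2).symm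
  map_smul x r a := by
    refine (M.toPreCoShf.fibreEquiv x).injective ?_
    refine Eq.trans ?_ (M.toPreCoShf.fibreEquiv_smul x _ _).symm
    refine Subtype.ext (funext fun U => ?_)
    refine (M.fibreEquiv_germ (r • a) U.1 U.2).trans ((map_smul (M.fibreOmega U.2) r a).trans ?_)
    exact congrArg (r • ·) (M.fibreEquiv_germ a U.1 U.2).symm

theorem PShf.isIso_toStalks (M : PShf R) :
    IsIso (C := PShf R) (X := M) (Y := M.toPreCoShf.toPShf) M.toStalks :=
  PShf.isIso_of_bijective _ Function.bijective_id ⟨M.germ_injective, M.germ_surjective⟩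

variable (R) in
/-- The functor `CoShf`, with values in the full subcategory of cosheaves. -/
noncomputable def toCoShf : PShf R ⥤ CoShf R :=
  (isCosheaf R).lift (coShf R) PShf.isCosheaf_toPreCoShf

variable (R) in
/-- The unit of the equivalence, as a natural isomorphism. -/
noncomputable def toStalksIso : 𝟭 (PShf R) ≅ toCoShf R ⋙ coEtale R :=
  NatIso.ofComponents
    (fun M => @asIso (PShf R) _ M M.toPreCoShf.toPShf M.toStalks M.isIso_toStalks) (by
    intro N M φ
    let Φ : PShf.Hom N M := φ
    refine PShf.Hom.ext' rfl (ContinuousMap.ext fun m => ?_)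
    refine PreCoShf.Total.ext_of_val (M := M.toPreCoShf) (Φ.comm m) fun U _ hU => ?_
    exact (PShf.sumHom_omega Φ (V := preim Φ.base U ⊓ ⊤) (U := U) inf_le_left
      ⟨m, hU, trivial⟩).symm)

/-! ### Morphisms of precosheaves -/

/-- The map `N(V) → M(U)` which a morphism of precosheaves over `f` induces when `V ⊆ f⁻¹(U)`.
These maps determine the morphism, and compose more simply than the maps `Ψ.app U V`. -/
def PreCoShf.Hom.mapOfLE {N M : PreCoShf R} (Ψ : PreCoShf.Hom N M) {U : Clopens M.X}
    {V : Clopens N.X} (h : V ≤ preim Ψ.base U) : N.F.obj V →L[R] M.F.obj U :=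
  (Ψ.app U ⊤).comp (N.cor (le_inf h le_top))

theorem PreCoShf.Hom.mapOfLE_cor {N M : PreCoShf R} (Ψ : PreCoShf.Hom N M) {U : Clopens M.X}
    {V V' : Clopens N.X} (hV : V ≤ V') (h : V' ≤ preim Ψ.base U) (a : N.F.obj V) :
    Ψ.mapOfLE h (N.cor hV a) = Ψ.mapOfLE (hV.trans h) a :=
  congrArg (Ψ.app U ⊤) (N.cor_cor _ _ a)

theorem PreCoShf.Hom.cor_mapOfLE {N M : PreCoShf R} (Ψ : PreCoShf.Hom N M) {U U' : Clopens M.X}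
    {V : Clopens N.X} (hU : U ≤ U') (h : V ≤ preim Ψ.base U) (a : N.F.obj V) :
    M.cor hU (Ψ.mapOfLE h a) = Ψ.mapOfLE (h.trans (preim_mono Ψ.base hU)) a :=
  (Ψ.naturality hU le_rfl _).symm.trans (congrArg (Ψ.app U' ⊤) (N.cor_cor _ _ a))

theorem PreCoShf.Hom.app_eq_mapOfLE {N M : PreCoShf R} (Ψ : PreCoShf.Hom N M) (U : Clopens M.X)
    (V : Clopens N.X) (a : N.F.obj (preim Ψ.base U ⊓ V)) :
    Ψ.app U V a = Ψ.mapOfLE inf_le_left a :=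
  (M.cor_self le_rfl _).symm.trans (Ψ.naturality le_rfl le_top a).symm

theorem PreCoShf.Hom.ext_mapOfLE {N M : PreCoShf R} {Φ Ψ : PreCoShf.Hom N M}
    (hbase : Φ.base = Ψ.base)
    (h : ∀ (U : Clopens M.X) (V : Clopens N.X) (hΦ : V ≤ preim Φ.base U)
      (hΨ : V ≤ preim Ψ.base U) (a : N.F.obj V), Φ.mapOfLE hΦ a = Ψ.mapOfLE hΨ a) : Φ = Ψ := by
  refine PreCoShf.Hom.ext' hbase fun U V hle a => ?_
  rw [Φ.app_eq_mapOfLE, Ψ.app_eq_mapOfLE, Ψ.mapOfLE_cor]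
  exact (h U _ _ _ a).symm

theorem PreCoShf.Hom.mapOfLE_id (M : PreCoShf R) {U V : Clopens M.X} (h : V ≤ U)
    (a : M.F.obj V) : (PreCoShf.Hom.id M).mapOfLE (h.trans (preim_id U).ge) a = M.cor h a :=
  M.cor_cor _ _ a

theorem PreCoShf.Hom.mapOfLE_comp {P N M : PreCoShf R} (Φ : PreCoShf.Hom P N)
    (Ψ : PreCoShf.Hom N M) {U : Clopens M.X} {V : Clopens N.X} {W : Clopens P.X}
    (h : V ≤ preim Ψ.base U) (k : W ≤ preim Φ.base V) (hk : W ≤ preim (Φ.comp Ψ).base U)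
    (a : P.F.obj W) : (Φ.comp Ψ).mapOfLE hk a = Ψ.mapOfLE h (Φ.mapOfLE k a) := by
  have hcomp : (Φ.comp Ψ).mapOfLE hk a = Ψ.mapOfLE le_rfl (Φ.app (preim Ψ.base U) ⊤
      (P.cor (U := preim (Φ.comp Ψ).base U ⊓ ⊤)
        (inf_le_inf_right ⊤ (preim_comp Ψ.base Φ.base U).le) (P.cor (le_inf hk le_top) a))) := rfl
  rw [hcomp, P.cor_cor, Φ.app_eq_mapOfLE, Φ.mapOfLE_cor, ← Φ.cor_mapOfLE h k, Ψ.mapOfLE_cor]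

/-- A morphism of precosheaves given by its maps `N(V) → M(U)` for `V ⊆ f⁻¹(U)`. -/
def PreCoShf.Hom.ofMapOfLE {N M : PreCoShf R} (f : C(N.X, M.X))
    (α : ∀ {U : Clopens M.X} {V : Clopens N.X}, V ≤ preim f U → N.F.obj V →L[R] M.F.obj U)
    (hN : ∀ {U : Clopens M.X} {V V' : Clopens N.X} (hV : V ≤ V') (h : V' ≤ preim f U) a,
      α h (N.cor hV a) = α (hV.trans h) a)
    (hM : ∀ {U U' : Clopens M.X} {V : Clopens N.X} (hU : U ≤ U') (h : V ≤ preim f U) a,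
      M.cor hU (α h a) = α (h.trans (preim_mono f hU)) a) : PreCoShf.Hom N M where
  base := f
  app _ _ := α inf_le_left
  naturality _ _ a := (hN _ _ a).trans (hM _ _ a).symm

theorem PreCoShf.Hom.mapOfLE_ofMapOfLE {N M : PreCoShf R} (f : C(N.X, M.X))
    (α : ∀ {U : Clopens M.X} {V : Clopens N.X}, V ≤ preim f U → N.F.obj V →L[R] M.F.obj U)
    (hN : ∀ {U : Clopens M.X} {V V' : Clopens N.X} (hV : V ≤ V') (h : V' ≤ preim f U) a,
      α h (N.cor hV a) = α (hV.trans h) a)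
    (hM : ∀ {U U' : Clopens M.X} {V : Clopens N.X} (hU : U ≤ U') (h : V ≤ preim f U) a,
      M.cor hU (α h a) = α (h.trans (preim_mono f hU)) a)
    {U : Clopens M.X} {V : Clopens N.X} (h : V ≤ preim f U) (a : N.F.obj V) :
    (PreCoShf.Hom.ofMapOfLE f α hN hM).mapOfLE h a = α h a :=
  hN _ _ a

theorem PreCoShf.Hom.totalMap_val {N M : PreCoShf R} (Ψ : PreCoShf.Hom N M) (n : N.Total)
    {U : Clopens M.X} {V : Clopens N.X} (h : V ≤ preim Ψ.base U) (hV : n.pt ∈ V)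
    (hU : (Ψ.totalMap n).pt ∈ U) :
    (Ψ.totalMap n).val.1 ⟨U, hU⟩ = Ψ.mapOfLE h (n.val.1 ⟨V, hV⟩) := by
  have hn : N.cor (le_inf h le_top) (n.val.1 ⟨V, hV⟩) = n.val.1 ⟨_, mem_preim_inf_top hU⟩ :=
    n.val.2 ⟨V, hV⟩ ⟨_, mem_preim_inf_top hU⟩ (le_inf h le_top)
  exact congrArg (Ψ.app U ⊤) hn.symm

/-- A bijective continuous linear map of profinite modules, as an isomorphism. -/
noncomputable def PMod.equivOfBijective {P Q : PMod R} (φ : P →L[R] Q)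
    (hφ : Function.Bijective φ) : P ≃L[R] Q where
  toLinearEquiv := LinearEquiv.ofBijective φ.toLinearMap hφ
  continuous_toFun := φ.continuous
  continuous_invFun := Continuous.continuous_symm_of_equiv_compact_to_t2
    (f := (LinearEquiv.ofBijective φ.toLinearMap hφ).toEquiv) φ.continuous

theorem le_preim_preim {X Y : Profinite.{u}} {f : C(Y, X)} {g : C(X, Y)}
    (hg : Function.LeftInverse g f) (V : Clopens Y) : V ≤ preim f (preim g V) :=
  fun y hy => (congrArg (· ∈ V) (hg y)).mpr hy

theorem preim_preim_le {X Y : Profinite.{u}} {f : C(Y, X)} {g : C(X, Y)}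
    (hg : Function.RightInverse g f) (U : Clopens X) : preim g (preim f U) ≤ U :=
  fun x hx => (congrArg (· ∈ U) (hg x)).mp hx

/-- The map `N(V) → M(g⁻¹(V))` induced by a morphism of precosheaves over `f`, where `g` is a left
inverse of `f`. -/
def PreCoShf.Hom.appPreim {N M : PreCoShf R} (Ψ : PreCoShf.Hom N M) {g : C(M.X, N.X)}
    (hg : Function.LeftInverse g Ψ.base) (V : Clopens N.X) :
    N.F.obj V →L[R] M.F.obj (preim g V) :=
  Ψ.mapOfLE (le_preim_preim hg V)

theorem PreCoShf.Hom.appPreim_cor {N M : PreCoShf R} (Ψ : PreCoShf.Hom N M) {g : C(M.X, N.X)}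
    (hg : Function.LeftInverse g Ψ.base) {V W : Clopens N.X} (h : V ≤ W) (a : N.F.obj V) :
    Ψ.appPreim hg W (N.cor h a) = M.cor (preim_mono g h) (Ψ.appPreim hg V a) :=
  (Ψ.mapOfLE_cor _ _ a).trans (Ψ.cor_mapOfLE _ _ a).symm

theorem PreCoShf.Hom.cor_appPreim {N M : PreCoShf R} (Ψ : PreCoShf.Hom N M) {g : C(M.X, N.X)}
    (hg : Function.LeftInverse g Ψ.base) {U : Clopens M.X} {V : Clopens N.X}
    (h : preim g V ≤ U) (a : N.F.obj V) :
    M.cor h (Ψ.appPreim hg V a) =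
      Ψ.mapOfLE ((le_preim_preim hg V).trans (preim_mono Ψ.base h)) a :=
  Ψ.cor_mapOfLE _ _ a

theorem PreCoShf.isIso_of_appPreim_bijective {N M : PreCoShf R} (Ψ : PreCoShf.Hom N M)
    {g : C(M.X, N.X)} (hl : Function.LeftInverse g Ψ.base)
    (hr : Function.RightInverse g Ψ.base)
    (hΨ : ∀ V, Function.Bijective (Ψ.appPreim hl V)) :
    IsIso (C := PreCoShf R) (X := N) (Y := M) Ψ := by
  let e (V) := PMod.equivOfBijective (Ψ.appPreim hl V) (hΨ V)
  have he (V) (b) : Ψ.appPreim hl V ((e V).symm b) = b := (e V).apply_symm_apply b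
  let α {V : Clopens N.X} {U : Clopens M.X} (h : U ≤ preim g V) : M.F.obj U →L[R] N.F.obj V :=
    ((e V).symm : M.F.obj (preim g V) →L[R] N.F.obj V).comp (M.cor h)
  let Θ : PreCoShf.Hom M N := PreCoShf.Hom.ofMapOfLE g α
    (fun {V U U'} hU h a => congrArg (e V).symm (M.cor_cor hU h a))
    (fun {V V' U} hV h a => (hΨ V').1 (by
      refine (Ψ.appPreim_cor hl hV _).trans ?_
      refine (congrArg (M.cor _) (he V _)).trans ((M.cor_cor _ _ a).trans (he V' _).symm)))
  have hΘ {V U} (h : U ≤ preim g V) (a) : Ψ.appPreim hl V (Θ.mapOfLE h a) = M.cor h a :=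
    (congrArg _ (PreCoShf.Hom.mapOfLE_ofMapOfLE g α _ _ h a)).trans (he V _)
  refine ⟨Θ, PreCoShf.Hom.ext_mapOfLE (ContinuousMap.ext hl) fun V W _ hle a => ?_,
    PreCoShf.Hom.ext_mapOfLE (ContinuousMap.ext hr) fun U W hle hle' a => ?_⟩
  · have hWV : W ≤ V := hle
    refine (Ψ.mapOfLE_comp Θ le_rfl (hWV.trans (le_preim_preim hl V)) _ a).trans ?_
    refine ((hΨ V).1 ((hΘ _ _).trans ?_)).trans (PreCoShf.Hom.mapOfLE_id N hWV a).symm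
    exact (M.cor_self _ _).trans (Ψ.mapOfLE_cor _ _ _).symm
  · refine (Θ.mapOfLE_comp Ψ le_rfl hle _ a).trans ?_
    refine (Ψ.cor_appPreim hl (preim_preim_le hr U) _).symm.trans ?_
    refine ((congrArg (M.cor _) (hΘ _ a)).trans (M.cor_cor _ _ a)).trans ?_
    exact (PreCoShf.Hom.mapOfLE_id M hle' a).symm

/-! ### Morphisms of cosheaves that are bijective on stalks -/

theorem clopens_induction {X : Profinite.{u}} (Q : Clopens X → Prop) (hbot : Q ⊥)
    (hmono : ∀ V W, V ≤ W → Q W → Q V)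
    (hsup : ∀ V W, Disjoint V W → Q V → Q W → Q (V ⊔ W)) (U : Clopens X)
    (hloc : ∀ x ∈ U, ∃ V, x ∈ V ∧ Q V) : Q U := by
  suffices ∃ V : Clopens X, (U : Set X) ⊆ V ∧ Q V by
    obtain ⟨V, hUV, hV⟩ := this
    exact hmono U V hUV hV
  refine U.isClosed.isCompact.induction_on (p := fun s => ∃ V : Clopens X, s ⊆ V ∧ Q V)
    ⟨⊥, Set.empty_subset _, hbot⟩ (fun s t hst ⟨V, hV, hQ⟩ => ⟨V, hst.trans hV, hQ⟩) ?_ ?_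
  · rintro s t ⟨V, hV, hQV⟩ ⟨W, hW, hQW⟩
    refine ⟨V ⊔ W \ V, ?_, hsup _ _ disjoint_sdiff_self_right hQV (hmono _ _ sdiff_le hQW)⟩
    rw [sup_sdiff_self_right]
    exact Set.union_subset_union hV hW
  · intro x hx
    obtain ⟨V, hxV, hQ⟩ := hloc x hx
    exact ⟨V, mem_nhdsWithin_of_mem_nhds (V.isOpen.mem_nhds hxV), V, subset_rfl, hQ⟩

theorem PreCoShf.exists_stalk_mem (M : PreCoShf R) (x : M.X) (T : ∀ V, Set (M.F.obj V))
    (hT : ∀ V, IsClosed (T V)) (hcor : ∀ V W (h : V ≤ W), ∀ a ∈ T V, M.cor h a ∈ T W)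
    (hne : ∀ V, x ∈ V → (T V).Nonempty) :
    ∃ s : M.stalk x, ∀ V, s.1 V ∈ T V.1 := by
  let D : {V : Clopens M.X // x ∈ V} ⥤ TopCat.{u} :=
    { obj := fun V => TopCat.of (T V.1)
      map := fun {V W} h => TopCat.ofHom ⟨fun a => ⟨M.cor h.le a.1, hcor _ _ _ a.1 a.2⟩,
        ((M.cor h.le).continuous.comp continuous_subtype_val).subtype_mk _⟩
      map_id := fun V => by ext a; exact M.cor_self _ a.1
      map_comp := fun f g => by ext a; exact (M.cor_cor f.le g.le a.1).symm }
  have : Nonempty {V : Clopens M.X // x ∈ V} := ⟨⟨⊤, trivial⟩⟩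
  have : IsCodirectedOrder {V : Clopens M.X // x ∈ V} :=
    ⟨fun V W => ⟨⟨V.1 ⊓ W.1, V.2, W.2⟩, (inf_le_left : V.1 ⊓ W.1 ≤ V.1),
      (inf_le_right : V.1 ⊓ W.1 ≤ W.1)⟩⟩
  have hnonempty (V) : Nonempty (D.obj V) := (hne V.1 V.2).to_subtype
  have hcompact (V) : CompactSpace (D.obj V) := isCompact_iff_compactSpace.mp (hT V.1).isCompact
  have ht2 (V) : T2Space (D.obj V) := inferInstanceAs (T2Space (T V.1))
  obtain ⟨t, ht⟩ := TopCat.nonempty_limitCone_of_compact_t2_cofiltered_system D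
  exact ⟨⟨fun V => (t V).1, fun V W h => congrArg Subtype.val (ht (homOfLE h))⟩, fun V => (t V).2⟩

/-- A family of closed subgroups `S(V) ≤ M(V)`, stable under corestriction and such that `S(V ⊔ W)`
is generated by the images of `S(V)` and `S(W)` when `V` and `W` are disjoint. -/
structure PreCoShf.ClosedSubcosheaf (M : PreCoShf R) where
  carrier : ∀ V : Clopens M.X, AddSubgroup (M.F.obj V)
  isClosed : ∀ V, IsClosed (carrier V : Set (M.F.obj V))
  cor_mem : ∀ {V W} (h : V ≤ W) {a}, a ∈ carrier V → M.cor h a ∈ carrier W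
  eq_zero_of_mem_bot : ∀ {a}, a ∈ carrier ⊥ → a = 0
  exists_eq_cor_add_cor : ∀ {V W}, Disjoint V W → ∀ a ∈ carrier (V ⊔ W),
    ∃ b ∈ carrier V, ∃ c ∈ carrier W, a = M.cor le_sup_left b + M.cor le_sup_right c

theorem PreCoShf.ClosedSubcosheaf.exists_stalk {M : PreCoShf R} (S : M.ClosedSubcosheaf)
    {U : Clopens M.X} {K : AddSubgroup (M.F.obj U)} (hK : IsOpen (K : Set (M.F.obj U))) {x : M.X}
    (hx : x ∈ U) (h : ∀ V (hVU : V ≤ U), x ∈ V → ∃ a ∈ S.carrier V, M.cor hVU a ∉ K) :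
    ∃ s : M.stalk x, (∀ V, s.1 V ∈ S.carrier V.1) ∧ s.1 ⟨U, hx⟩ ∉ K := by
  have hclosed (V : Clopens M.X) : IsClosed {a : M.F.obj V | ∀ hVU : V ≤ U, M.cor hVU a ∉ K} := by
    rw [Set.ofPred_forall]
    exact isClosed_iInter fun hVU => hK.isClosed_compl.preimage (M.cor hVU).continuous
  obtain ⟨s, hs⟩ := M.exists_stalk_mem x
    (fun V => {a | a ∈ S.carrier V ∧ ∀ hVU : V ≤ U, M.cor hVU a ∉ K})
    (fun V => (S.isClosed V).inter (hclosed V))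
    (fun V W hVW a ha => ⟨S.cor_mem hVW ha.1, fun hWU => by rw [M.cor_cor]; exact ha.2 _⟩)
    (fun V hxV => by
      obtain ⟨a, ha, haK⟩ := h (V ⊓ U) inf_le_right ⟨hxV, hx⟩
      exact ⟨M.cor inf_le_left a, S.cor_mem _ ha, fun hVU => by rwa [M.cor_cor]⟩)
  refine ⟨s, fun V => (hs V).1, ?_⟩
  rw [← M.cor_self le_rfl (s.1 ⟨U, hx⟩)]
  exact (hs ⟨U, hx⟩).2 le_rfl

theorem PreCoShf.ClosedSubcosheaf.carrier_le_of_stalk_mem {M : PreCoShf R}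
    (S : M.ClosedSubcosheaf) {U : Clopens M.X} {B : AddSubgroup (M.F.obj U)}
    (hB : IsClosed (B : Set (M.F.obj U)))
    (h : ∀ (x : M.X) (hx : x ∈ U) (s : M.stalk x), (∀ V, s.1 V ∈ S.carrier V.1) →
      s.1 ⟨U, hx⟩ ∈ B) : S.carrier U ≤ B := by
  intro a ha
  by_contra haB
  obtain ⟨K, hK, hBK, haK⟩ := exists_isOpen_addSubgroup_of_notMem hB haB
  let Q (V : Clopens M.X) : Prop := ∃ hVU : V ≤ U, ∀ a ∈ S.carrier V, M.cor hVU a ∈ K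
  suffices Q U by
    obtain ⟨_, hU⟩ := this
    exact haK (M.cor_self _ a ▸ hU a ha)
  refine clopens_induction Q ⟨bot_le, fun a ha => ?_⟩ (fun V W hVW ⟨hWU, hW⟩ => ?_)
    (fun V W hVW ⟨hVU, hV⟩ ⟨hWU, hW⟩ => ?_) U fun x hx => ?_
  · rw [S.eq_zero_of_mem_bot ha, map_zero]
    exact zero_mem K
  · refine ⟨hVW.trans hWU, fun a ha => ?_⟩
    rw [← M.cor_cor hVW hWU]
    exact hW _ (S.cor_mem hVW ha)
  · refine ⟨sup_le hVU hWU, fun a ha => ?_⟩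
    obtain ⟨b, hb, c, hc, rfl⟩ := S.exists_eq_cor_add_cor hVW a ha
    rw [map_add, M.cor_cor, M.cor_cor]
    exact add_mem (hV b hb) (hW c hc)
  · by_contra! hQ
    obtain ⟨s, hs, hsK⟩ := S.exists_stalk hK hx fun V hVU hxV => by
      by_contra! hV
      exact hQ V hxV ⟨hVU, hV⟩
    exact hsK (hBK (h x hx s hs))

/-- A cosheaf as a subcosheaf of itself. -/
def PreCoShf.ClosedSubcosheaf.top {M : PreCoShf R} (hM : isCosheaf R M) :
    M.ClosedSubcosheaf where
  carrier _ := ⊤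
  isClosed _ := isClosed_univ
  cor_mem _ _ _ := AddSubgroup.mem_top _
  eq_zero_of_mem_bot {a} _ := (subsingleton_bot hM).elim a 0
  exists_eq_cor_add_cor _ a _ := by
    obtain ⟨b, c, h⟩ := exists_cor_add_cor hM a
    exact ⟨b, AddSubgroup.mem_top _, c, AddSubgroup.mem_top _, h⟩

/-- The kernels of the maps `N(V) → M(g⁻¹(V))` induced by a morphism of cosheaves over `f`, where
`g` is a left inverse of `f`. -/
def PreCoShf.Hom.ker {N M : PreCoShf R} (Ψ : PreCoShf.Hom N M) (hN : isCosheaf R N)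
    (hM : isCosheaf R M) {g : C(M.X, N.X)} (hg : Function.LeftInverse g Ψ.base) :
    N.ClosedSubcosheaf where
  carrier V := (Ψ.appPreim hg V : N.F.obj V →+ M.F.obj (preim g V)).ker
  isClosed V := isClosed_singleton.preimage (Ψ.appPreim hg V).continuous
  cor_mem h a ha :=
    (Ψ.appPreim_cor hg h a).trans ((congrArg (M.cor _) ha).trans (map_zero _))
  eq_zero_of_mem_bot {a} _ := (subsingleton_bot hN).elim a 0
  exists_eq_cor_add_cor {V W} hVW a ha := by
    obtain ⟨b, c, rfl⟩ := exists_cor_add_cor hN a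
    have hdisj : Disjoint (preim g V) (preim g W) :=
      disjoint_iff_inf_le.mpr fun x hx => hVW.le_bot hx
    have hsum : M.cor (preim_mono g le_sup_left) (Ψ.appPreim hg V b) +
        M.cor (preim_mono g le_sup_right) (Ψ.appPreim hg W c) = 0 := by
      rw [← Ψ.appPreim_cor, ← Ψ.appPreim_cor, ← map_add]
      exact ha
    obtain ⟨hb, hc⟩ := eq_zero_of_cor_add_cor hM hdisj hsum
    exact ⟨b, hb, c, hc, rfl⟩

theorem PreCoShf.Hom.base_bijective {N M : PreCoShf R} (Ψ : PreCoShf.Hom N M)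
    (h : Function.Bijective Ψ.totalMap) : Function.Bijective Ψ.base := by
  have hzero (y) : Ψ.totalMap ⟨y, 0⟩ = ⟨Ψ.base y, 0⟩ :=
    congrArg (PreCoShf.Total.mk _) (map_zero (Ψ.stalkMap y))
  refine ⟨fun y z hyz => ?_, fun x => ?_⟩
  · have h0 : Ψ.totalMap ⟨y, 0⟩ = Ψ.totalMap ⟨z, 0⟩ := by rw [hzero, hzero, hyz]
    exact congrArg PreCoShf.Total.pt (h.1 h0)
  · obtain ⟨n, hn⟩ := h.2 ⟨x, 0⟩
    exact ⟨n.pt, congrArg PreCoShf.Total.pt hn⟩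

theorem PreCoShf.Hom.appPreim_surjective {N M : PreCoShf R} (Ψ : PreCoShf.Hom N M)
    (hM : isCosheaf R M) (h : Function.Surjective Ψ.totalMap) {g : C(M.X, N.X)}
    (hg : Function.LeftInverse g Ψ.base) (V : Clopens N.X) :
    Function.Surjective (Ψ.appPreim hg V) := by
  let B : AddSubgroup (M.F.obj (preim g V)) :=
    (Ψ.appPreim hg V : N.F.obj V →+ M.F.obj (preim g V)).range
  have hB : IsClosed (B : Set (M.F.obj (preim g V))) :=
    (isCompact_range (Ψ.appPreim hg V).continuous).isClosed
  have hstalk (m : M.Total) (hm : m.pt ∈ preim g V) : m.val.1 ⟨_, hm⟩ ∈ B := by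
    obtain ⟨n, rfl⟩ := h m
    have hn : n.pt ∈ V := (congrArg (· ∈ V) (hg n.pt)).mp hm
    exact ⟨n.val.1 ⟨V, hn⟩, (Ψ.totalMap_val n (le_preim_preim hg V) hn hm).symm⟩
  exact fun a => (ClosedSubcosheaf.top hM).carrier_le_of_stalk_mem hB
    (fun x hx s _ => hstalk ⟨x, s⟩ hx) (AddSubgroup.mem_top a)

theorem PreCoShf.Hom.appPreim_injective {N M : PreCoShf R} (Ψ : PreCoShf.Hom N M)
    (hN : isCosheaf R N) (hM : isCosheaf R M) (h : Function.Injective Ψ.totalMap)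
    {g : C(M.X, N.X)} (hl : Function.LeftInverse g Ψ.base)
    (hr : Function.RightInverse g Ψ.base) (V : Clopens N.X) :
    Function.Injective (Ψ.appPreim hl V) := by
  refine (injective_iff_map_eq_zero _).2 fun a ha =>
    (Ψ.ker hN hM hl).carrier_le_of_stalk_mem (B := ⊥) isClosed_singleton (fun y hy s hs => ?_) ha
  have hcomp (U : Clopens M.X) (hU : y ∈ preim Ψ.base U) :
      Ψ.mapOfLE le_rfl (s.1 ⟨preim Ψ.base U, hU⟩) = 0 := by
    refine (Ψ.cor_appPreim hl (preim_preim_le hr U) _).symm.trans ?_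
    exact (congrArg (M.cor _) (hs ⟨_, hU⟩)).trans (map_zero _)
  have hΨs : Ψ.totalMap ⟨y, s⟩ = Ψ.totalMap ⟨y, 0⟩ :=
    PreCoShf.Total.ext_of_val rfl fun U hU _ => by
      rw [Ψ.totalMap_val ⟨y, s⟩ le_rfl hU, Ψ.totalMap_val ⟨y, 0⟩ le_rfl hU]
      exact (hcomp U hU).trans (map_zero _).symm
  obtain rfl : s = 0 := eq_of_heq (PreCoShf.Total.mk.inj (h hΨs)).2
  rfl

theorem PreCoShf.isIso_of_totalMap_bijective {N M : PreCoShf R} (hN : isCosheaf R N)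
    (hM : isCosheaf R M) (Ψ : PreCoShf.Hom N M) (h : Function.Bijective Ψ.totalMap) :
    IsIso (C := PreCoShf R) (X := N) (Y := M) Ψ := by
  let e : N.X ≃ₜ M.X := Continuous.homeoOfEquivCompactToT2
    (f := Equiv.ofBijective Ψ.base (Ψ.base_bijective h)) Ψ.base.continuous
  let g : C(M.X, N.X) := ⟨e.symm, e.symm.continuous⟩
  have hl : Function.LeftInverse g Ψ.base := e.left_inv
  have hr : Function.RightInverse g Ψ.base := e.right_inv
  exact isIso_of_appPreim_bijective Ψ hl hr fun V =>
    ⟨Ψ.appPreim_injective hN hM h.1 hl hr V, Ψ.appPreim_surjective hM h.2 hl V⟩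

/-! ### The counit -/

/-- Evaluation `(m, x) ↦ cor_x^U(m)` of the points of the `sheaf'` of stalks lying over `U`. -/
noncomputable def PreCoShf.evHom (M : PreCoShf R) (U : Clopens M.X) :
    M.toPShf.HomOver U (M.F.obj U) where
  toMap := ⟨fun m => M.ev U m.1, (M.continuous_ev U).comp continuous_subtype_val⟩
  map_add x _ a b := M.ev_add U x a b
  map_smul x _ r a := M.ev_smul U x r a

theorem PreCoShf.cor_ev (M : PreCoShf R) {U V : Clopens M.X} (h : U ≤ V) {m : M.Total}
    (hm : m.pt ∈ U) : M.cor h (M.ev U m) = M.ev V m := by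
  rw [M.ev_of_mem hm, M.ev_of_mem (h hm)]
  exact m.val.2 ⟨U, hm⟩ ⟨V, h hm⟩ h

/-- The map `⊞_{u ∈ U} M_u → M(U)` induced by evaluation. -/
noncomputable def PreCoShf.sumEv (M : PreCoShf R) (U : Clopens M.X) :
    M.toPShf.directSum U →L[R] M.F.obj U :=
  M.toPShf.lift (M.evHom U)

theorem PreCoShf.sumEv_omega (M : PreCoShf R) {U : Clopens M.X} (m : M.toPShf.Over U) :
    M.sumEv U ((M.toPShf.omega U).toMap m) = M.ev U m.1 :=
  M.toPShf.lift_omega (M.evHom U) m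

theorem PreCoShf.sumEv_cor (M : PreCoShf R) {U V : Clopens M.X} (h : U ≤ V)
    (a : M.toPShf.directSum U) : M.sumEv V (M.toPShf.cor h a) = M.cor h (M.sumEv U a) := by
  have key : (M.sumEv V).comp (M.toPShf.cor h) = (M.cor h).comp (M.sumEv U) := by
    refine M.toPShf.directSum_ext fun m => ?_
    refine (congrArg (M.sumEv V) (M.toPShf.cor_omega h m)).trans ((M.sumEv_omega _).trans ?_)
    exact (M.cor_ev h m.2).symm.trans (congrArg (M.cor h) (M.sumEv_omega m).symm)
  exact congrArg (· a) key

/-- The counit of the equivalence: the maps `sumEv`, as a morphism from the cosheaf of the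
`sheaf'` of stalks of `M` to `M`. -/
noncomputable def PreCoShf.ofStalks (M : PreCoShf R) : PreCoShf.Hom M.toPShf.toPreCoShf M :=
  PreCoShf.Hom.ofMapOfLE (N := M.toPShf.toPreCoShf) (ContinuousMap.id M.X)
    (fun {U _} h => (M.sumEv U).comp (M.toPShf.cor h))
    (fun hV h a => congrArg (M.sumEv _) (M.toPShf.cor_cor hV h a))
    (fun {U _ _} hU h a => (M.sumEv_cor hU _).symm.trans
      (congrArg (M.sumEv _) (M.toPShf.cor_cor (V := U) h hU a)))

theorem PreCoShf.mapOfLE_ofStalks_omega (M : PreCoShf R) {U V : Clopens M.X}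
    (h : V ≤ preim M.ofStalks.base U) (m : M.toPShf.Over V) :
    M.ofStalks.mapOfLE h ((M.toPShf.omega V).toMap m) = M.ev U m.1 := by
  refine (congrArg (M.sumEv U) (M.toPShf.cor_cor _ _ _)).trans ?_
  exact (congrArg (M.sumEv U) (M.toPShf.cor_omega (V := U) h m)).trans (M.sumEv_omega _)

theorem PreCoShf.totalMap_ofStalks_germ (M : PreCoShf R) (m : M.Total) :
    M.ofStalks.totalMap (M.toPShf.germ m) = m := by
  refine PreCoShf.Total.ext_of_val rfl fun U hU hU' => ?_
  refine (M.ofStalks.totalMap_val (M.toPShf.germ m) (V := U) le_rfl hU' hU).trans ?_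
  exact (M.mapOfLE_ofStalks_omega le_rfl ⟨m, hU'⟩).trans (M.ev_of_mem hU')

theorem PreCoShf.isIso_ofStalks {M : PreCoShf R} (hM : isCosheaf R M) :
    IsIso (C := PreCoShf R) (X := M.toPShf.toPreCoShf) (Y := M) M.ofStalks := by
  have hgerm : Function.Bijective M.toPShf.germ :=
    ⟨M.toPShf.germ_injective, M.toPShf.germ_surjective⟩
  have htriangle : M.ofStalks.totalMap ∘ M.toPShf.germ = id :=
    funext M.totalMap_ofStalks_germ
  exact isIso_of_totalMap_bijective M.toPShf.isCosheaf_toPreCoShf hM M.ofStalks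
    ((Function.Bijective.of_comp_iff _ hgerm).mp (htriangle ▸ Function.bijective_id))

theorem PShf.hom_ext_omega {N : PShf R} {M : PreCoShf R}
    {Φ Ψ : PreCoShf.Hom N.toPreCoShf M} (hbase : Φ.base = Ψ.base)
    (h : ∀ (U : Clopens M.X) (V : Clopens N.X) (hΦ : V ≤ preim Φ.base U)
      (hΨ : V ≤ preim Ψ.base U) (m : N.Over V),
      Φ.mapOfLE hΦ ((N.omega V).toMap m) = Ψ.mapOfLE hΨ ((N.omega V).toMap m)) : Φ = Ψ :=
  PreCoShf.Hom.ext_mapOfLE hbase fun U V hΦ hΨ a =>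
    congrArg (fun φ : N.directSum V →L[R] M.F.obj U => φ a) (N.directSum_ext (h U V hΦ hΨ))

theorem PShf.Hom.mapOfLE_toPreCoShf {N M : PShf R} (φ : PShf.Hom N M) {U : Clopens M.X}
    {V : Clopens N.X} (h : V ≤ preim φ.base U) (m : N.Over V) :
    φ.toPreCoShf.mapOfLE h ((N.omega V).toMap m) =
      (M.omega U).toMap ⟨φ.map m.1, φ.mem_of_le h m⟩ :=
  (congrArg (PShf.sumHom φ _) (N.cor_omega _ m)).trans (PShf.sumHom_omega φ _ _)

theorem PreCoShf.ofStalks_naturality {N M : PreCoShf R} (Ψ : PreCoShf.Hom N M) :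
    Ψ.toPShf.toPreCoShf.comp M.ofStalks = N.ofStalks.comp Ψ := by
  refine PShf.hom_ext_omega rfl fun U V hle _ m => ?_
  have hV : V ≤ preim Ψ.base U := hle
  have hU : (Ψ.totalMap m.1).pt ∈ U := hV m.2
  have hl := (Ψ.toPShf.toPreCoShf.mapOfLE_comp M.ofStalks (U := U) (V := U) le_rfl hV hle _).trans
    ((congrArg (M.ofStalks.mapOfLE le_rfl) (Ψ.toPShf.mapOfLE_toPreCoShf hV m)).trans
      (M.mapOfLE_ofStalks_omega le_rfl _))
  have hr := (N.ofStalks.mapOfLE_comp Ψ hV (le_refl V) hle _).trans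
    (congrArg (Ψ.mapOfLE hV) (N.mapOfLE_ofStalks_omega le_rfl m))
  refine hl.trans (Eq.trans ?_ hr.symm)
  refine (M.ev_of_mem hU).trans ((Ψ.totalMap_val m.1 hV m.2 hU).trans ?_)
  exact congrArg (Ψ.mapOfLE hV) (N.ev_of_mem m.2).symm

variable (R) in
/-- The counit of the equivalence, as a natural isomorphism. -/
noncomputable def ofStalksIso : coEtale R ⋙ toCoShf R ≅ 𝟭 (CoShf R) :=
  NatIso.ofComponents
    (fun M => (isCosheaf R).isoMk (@asIso (PreCoShf R) _ _ _ _ (PreCoShf.isIso_ofStalks M.2)))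
    fun Ψ => ObjectProperty.hom_ext _ (PreCoShf.ofStalks_naturality Ψ.hom)

end ProfSheaf

theorem mainTheorem5_general (R : Type u) [Ring R] [TopologicalSpace R] :
    ∃ e : ProfSheaf.CoShf R ≌ ProfSheaf.PShf R,
      e.functor = ProfSheaf.coEtale R ∧
        e.inverse ⋙ (ProfSheaf.isCosheaf R).ι = ProfSheaf.coShf R :=
  ⟨CategoryTheory.Equivalence.mk (ProfSheaf.coEtale R) (ProfSheaf.toCoShf R)
    (ProfSheaf.ofStalksIso R).symm (ProfSheaf.toStalksIso R).symm, rfl, rfl⟩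

theorem mainTheorem5 (R : Type u) [Ring R] [TopologicalSpace R] [IsTopologicalRing R]
    [CompactSpace R] [T2Space R] [TotallyDisconnectedSpace R] :
    ∃ e : ProfSheaf.CoShf R ≌ ProfSheaf.PShf R,
      e.functor = ProfSheaf.coEtale R ∧
      e.inverse ⋙ (ProfSheaf.isCosheaf R).ι = ProfSheaf.coShf R :=
  mainTheorem5_general R
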